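/- **Weyl law.** Let $X=\mathbb R_x\times\mathbb S^1_y$ with $\mathbb S^1=\mathbb R/2\pi\mathbb Z$, equipped with Lebesgue measure $dx\,dy$, and let $L^2_0(X)$ be the orthogonal complement in $L^2(X)$ (complex valued) of the functions that depend only on $x$. For $s\in\mathbb R$ let $P_s=-\partial_x^2-(x^2+s^2)\,\partial_y^2$, as an operator on $L^2_0(X)$ with domain $$D_s=\{u\in L^2_0(X):\ \partial_x^2u\in L^2(X),\ (x^2+s^2)\,\partial_y^2u\in L^2(X)\},$$ the derivatives being taken in the sense of distributions. For $E\in\mathbb R$ let $N_{P_s}(E)$ be the number of eigenvalues of $P_s$ that are less than or equal to $E$, counted with multiplicity. Then $N_{P_s}(E)$ is finite for all $s,E\in\mathbb R$, and the following assertions hold. 1. For $s=0$, $N_{P_0}(E)=E\ln E+O(E)$ as $E\to+\infty$. 2. For every fixed $s\neq 0$, $N_{P_s}(E)=E\ln\sqrt E+O(E)$ as $E\to+\infty$ (the constant in $O(E)$ may depend on $s$). -/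

import Mathlib

open MeasureTheory Filter Asymptotics
open scoped Topology ContDiff ENNReal

noncomputable section

namespace Grushin

/-! ### The cylinder, its test functions and its Lebesgue spaces -/

instance factTwoPiPos : Fact (0 < 2 * Real.pi) := ⟨Real.two_pi_pos⟩

/-- The cylinder `ℝ × 𝕊¹`, with `𝕊¹ = ℝ / 2πℤ`. Its `volume` is the Lebesgue measure `dx dy`,
of total mass `2π` in the variable `y`. -/
abbrev Cyl : Type := ℝ × AddCircle (2 * Real.pi)

/-- The partial derivative in the direction of the axis of the cylinder. -/
def dX (φ : Cyl → ℂ) (p : Cyl) : ℂ :=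
  deriv (fun t : ℝ => φ (t, p.2)) p.1

/-- The partial derivative in the direction of the circle. -/
def dY (φ : Cyl → ℂ) (p : Cyl) : ℂ :=
  deriv (fun t : ℝ => φ (p.1, p.2 + (t : AddCircle (2 * Real.pi)))) 0

/-- Smooth functions with compact support on the cylinder; smoothness is read on the universal
cover `ℝ × ℝ`. -/
structure IsTest (φ : Cyl → ℂ) : Prop where
  smooth : ContDiff ℝ ∞
    (fun q : ℝ × ℝ => φ (q.1, (q.2 : AddCircle (2 * Real.pi))))
  compact : HasCompactSupport φ

/-- The complex Hilbert space `L²(X)` of the cylinder. -/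
abbrev L2 : Type := Lp ℂ 2 (volume : Measure Cyl)

/-- The elements of `L²(X)` that depend only on `x`. -/
def axial : Submodule ℂ L2 where
  carrier := {h | ∃ f : ℝ → ℂ, (h : Cyl → ℂ) =ᵐ[volume] fun p => f p.1}
  zero_mem' := ⟨0, by filter_upwards [Lp.coeFn_zero ℂ 2 (volume : Measure Cyl)] with p hp; exact hp⟩
  add_mem' := by
    rintro a b ⟨f, hf⟩ ⟨g, hg⟩
    refine ⟨f + g, ?_⟩
    filter_upwards [Lp.coeFn_add a b, hf, hg] with p h1 h2 h3
    rw [h1, Pi.add_apply, h2, h3, Pi.add_apply]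
  smul_mem' := by
    rintro c a ⟨f, hf⟩
    refine ⟨c • f, ?_⟩
    filter_upwards [Lp.coeFn_smul c a, hf] with p h1 h2
    rw [h1, Pi.smul_apply, h2, Pi.smul_apply]

/-- `L²₀(X)`: the orthogonal complement in `L²(X)` of the functions that depend only on `x`. -/
abbrev L20 : Submodule ℂ L2 := axialᗮ

/-! ### Weak derivatives -/

/-- `f = ∂ₓ² u` in the sense of distributions. -/
def HasWeakDXX (u f : L2) : Prop :=
  ∀ φ : Cyl → ℂ, IsTest φ → ∫ p, u p * dX (dX φ) p = ∫ p, f p * φ p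

/-- `g = V(x) ∂_y² u` in the sense of distributions. -/
def HasWeakVDYY (V : C(ℝ, ℝ)) (u g : L2) : Prop :=
  ∀ φ : Cyl → ℂ, IsTest φ → ∫ p, u p * ((V p.1 : ℂ) * dY (dY φ) p) = ∫ p, g p * φ p

/-! ### Helper facts: test functions -/

theorem isTest_continuous {φ : Cyl → ℂ} (h : IsTest φ) : Continuous φ := by
  have hq : IsOpenQuotientMap
      (Prod.map (id : ℝ → ℝ) (fun y : ℝ => (y : AddCircle (2 * Real.pi)))) :=
    IsOpenQuotientMap.id.prodMap QuotientAddGroup.isOpenQuotientMap_mk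
  rw [← hq.continuous_comp_iff]
  exact h.smooth.continuous

theorem isTest_dX {φ : Cyl → ℂ} (h : IsTest φ) : IsTest (dX φ) := by
  constructor
  · have hF := h.smooth
    set F : ℝ × ℝ → ℂ := fun q => φ (q.1, (q.2 : AddCircle (2 * Real.pi))) with hFdef
    have hd : Differentiable ℝ F := hF.differentiable (by simp)
    have : (fun q : ℝ × ℝ => dX φ (q.1, (q.2 : AddCircle (2 * Real.pi))))
        = fun q => fderiv ℝ F q (1, 0) := by
      funext q
      have h1 : HasDerivAt (fun t : ℝ => (t, q.2)) ((1 : ℝ), (0 : ℝ)) q.1 :=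
        (hasDerivAt_id q.1).prodMk (hasDerivAt_const q.1 q.2)
      have h2 := (hd (q.1, q.2)).hasFDerivAt.comp_hasDerivAt q.1 h1
      exact h2.deriv
    rw [this]
    exact (hF.fderiv_right (m := ∞) (by simp)).clm_apply contDiff_const
  · refine h.compact.mono' fun p hp => ?_
    by_contra hcon
    apply hp
    have h0 : φ =ᶠ[𝓝 p] 0 := notMem_tsupport_iff_eventuallyEq.mp hcon
    have hc : Tendsto (fun t : ℝ => ((t, p.2) : Cyl)) (𝓝 p.1) (𝓝 p) := by
      have : Continuous (fun t : ℝ => ((t, p.2) : Cyl)) := by fun_prop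
      exact this.tendsto p.1
    have h1 : (fun t : ℝ => φ (t, p.2)) =ᶠ[𝓝 p.1] fun _ => (0 : ℂ) := hc.eventually h0
    show deriv _ _ = 0
    rw [h1.deriv_eq, deriv_const]

theorem isTest_dY {φ : Cyl → ℂ} (h : IsTest φ) : IsTest (dY φ) := by
  constructor
  · have hF := h.smooth
    set F : ℝ × ℝ → ℂ := fun q => φ (q.1, (q.2 : AddCircle (2 * Real.pi))) with hFdef
    have hd : Differentiable ℝ F := hF.differentiable (by simp)
    have : (fun q : ℝ × ℝ => dY φ (q.1, (q.2 : AddCircle (2 * Real.pi))))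
        = fun q => fderiv ℝ F q (0, 1) := by
      funext q
      have h1 : HasDerivAt (fun t : ℝ => (q.1, q.2 + t)) ((0 : ℝ), (1 : ℝ)) 0 :=
        (hasDerivAt_const 0 q.1).prodMk ((hasDerivAt_id 0).const_add q.2)
      have h2 := (hd (q.1, q.2 + 0)).hasFDerivAt.comp_hasDerivAt 0 h1
      have h3 := h2.deriv
      simp only [add_zero] at h3
      rw [← h3]
      simp [dY, F, Function.comp_def]
    rw [this]
    exact (hF.fderiv_right (m := ∞) (by simp)).clm_apply contDiff_const
  · refine h.compact.mono' fun p hp => ?_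
    by_contra hcon
    apply hp
    have h0 : φ =ᶠ[𝓝 p] 0 := notMem_tsupport_iff_eventuallyEq.mp hcon
    have hc : Tendsto (fun t : ℝ => ((p.1, p.2 + (t : AddCircle (2 * Real.pi))) : Cyl))
        (𝓝 0) (𝓝 p) := by
      have h4 : Continuous (fun t : ℝ => (t : AddCircle (2 * Real.pi))) :=
        AddCircle.continuous_mk' _
      have : Continuous (fun t : ℝ => ((p.1, p.2 + (t : AddCircle (2 * Real.pi))) : Cyl)) := by
        fun_prop
      have h5 := this.tendsto 0
      simpa using h5
    have h1 : (fun t : ℝ => φ (p.1, p.2 + (t : AddCircle (2 * Real.pi)))) =ᶠ[𝓝 0]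
        fun _ => (0 : ℂ) := hc.eventually h0
    show deriv _ _ = 0
    rw [h1.deriv_eq, deriv_const]

theorem integrable_mul_of_compact (u : L2) {ψ : Cyl → ℂ} (hc : Continuous ψ)
    (hs : HasCompactSupport ψ) : Integrable (fun p => u p * ψ p) :=
  (Lp.memLp u).integrable_mul (hc.memLp_of_hasCompactSupport (p := 2) hs)

theorem integrable_mul_test (u : L2) {φ : Cyl → ℂ} (h : IsTest φ) :
    Integrable (fun p => u p * φ p) :=
  integrable_mul_of_compact u (isTest_continuous h) h.compact

theorem integrable_mul_V (V : C(ℝ, ℝ)) (u : L2) {φ : Cyl → ℂ} (h : IsTest φ) :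
    Integrable (fun p => u p * ((V p.1 : ℂ) * φ p)) :=
  integrable_mul_of_compact u
    (((Complex.continuous_ofReal.comp V.continuous).comp continuous_fst).mul
      (isTest_continuous h)) h.compact.mul_left

theorem integral_add_mul (a b : L2) {ψ : Cyl → ℂ}
    (ha : Integrable (fun p => a p * ψ p)) (hb : Integrable (fun p => b p * ψ p)) :
    ∫ p, (a + b : L2) p * ψ p = (∫ p, a p * ψ p) + ∫ p, b p * ψ p := by
  rw [← integral_add ha hb]
  refine integral_congr_ae ?_
  filter_upwards [Lp.coeFn_add a b] with p hp
  rw [hp, Pi.add_apply, add_mul]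

theorem integral_smul_mul (c : ℂ) (a : L2) (ψ : Cyl → ℂ) :
    ∫ p, (c • a : L2) p * ψ p = c * ∫ p, a p * ψ p := by
  rw [← integral_const_mul]
  refine integral_congr_ae ?_
  filter_upwards [Lp.coeFn_smul c a] with p hp
  rw [hp, Pi.smul_apply, smul_eq_mul, mul_assoc]

theorem hasWeakDXX_add {u v f g : L2} (h1 : HasWeakDXX u f) (h2 : HasWeakDXX v g) :
    HasWeakDXX (u + v) (f + g) := by
  intro φ hφ
  have h := isTest_dX (isTest_dX hφ)
  rw [integral_add_mul _ _ (integrable_mul_test u h) (integrable_mul_test v h),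
    integral_add_mul _ _ (integrable_mul_test f hφ) (integrable_mul_test g hφ), h1 φ hφ, h2 φ hφ]

theorem hasWeakDXX_smul (c : ℂ) {u f : L2} (h1 : HasWeakDXX u f) :
    HasWeakDXX (c • u) (c • f) := by
  intro φ hφ
  rw [integral_smul_mul, integral_smul_mul, h1 φ hφ]

theorem hasWeakVDYY_add {V : C(ℝ, ℝ)} {u v f g : L2} (h1 : HasWeakVDYY V u f)
    (h2 : HasWeakVDYY V v g) : HasWeakVDYY V (u + v) (f + g) := by
  intro φ hφ
  have h := isTest_dY (isTest_dY hφ)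
  rw [integral_add_mul _ _ (integrable_mul_V V u h) (integrable_mul_V V v h),
    integral_add_mul _ _ (integrable_mul_test f hφ) (integrable_mul_test g hφ), h1 φ hφ, h2 φ hφ]

theorem hasWeakVDYY_smul {V : C(ℝ, ℝ)} (c : ℂ) {u f : L2} (h1 : HasWeakVDYY V u f) :
    HasWeakVDYY V (c • u) (c • f) := by
  intro φ hφ
  rw [integral_smul_mul, integral_smul_mul, h1 φ hφ]

/-! ### Helper facts: uniqueness of weak derivatives -/

/-- The test function `ψ(x) e^{iky}`. -/
def modeTest (ψ : ℝ → ℝ) (k : ℤ) (p : Cyl) : ℂ := (ψ p.1 : ℂ) * fourier k p.2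

theorem isTest_modeTest {ψ : ℝ → ℝ} (h : ContDiff ℝ ∞ ψ) (hc : HasCompactSupport ψ) (k : ℤ) :
    IsTest (modeTest ψ k) := by
  constructor
  · simp only [modeTest, fourier_coe_apply]
    have h1 : ContDiff ℝ ∞ (fun q : ℝ × ℝ => ((ψ q.1 : ℝ) : ℂ)) :=
      Complex.ofRealCLM.contDiff.comp (h.comp contDiff_fst)
    have h2 : ContDiff ℝ ∞ (fun q : ℝ × ℝ => ((q.2 : ℝ) : ℂ)) :=
      Complex.ofRealCLM.contDiff.comp contDiff_snd
    exact h1.mul (((contDiff_const.mul h2).div_const _).cexp)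
  · refine HasCompactSupport.intro (K := tsupport ψ ×ˢ Set.univ)
      (hc.isCompact.prod isCompact_univ) fun p hp => ?_
    have : p.1 ∉ tsupport ψ := fun hh => hp ⟨hh, trivial⟩
    simp [modeTest, image_eq_zero_of_notMem_tsupport this]

theorem mode_locallyIntegrable (f : L2) (k : ℤ) :
    LocallyIntegrable (fun x : ℝ => ∫ y, f (x, y) * fourier k y) := by
  rw [locallyIntegrable_iff]
  intro K hK
  have hfin : IsFiniteMeasure ((volume : Measure ℝ).restrict K) :=
    ⟨by simpa using hK.measure_lt_top⟩
  have h1 : MemLp (f : Cyl → ℂ) 2 (((volume : Measure ℝ).restrict K).prod volume) := by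
    refine (Lp.memLp f).mono_measure ?_
    rw [← Measure.restrict_univ (μ := (volume : Measure (AddCircle (2 * Real.pi)))),
      Measure.prod_restrict]
    exact Measure.restrict_le_self
  have h2 : Integrable (fun p : Cyl => f p * fourier k p.2)
      (((volume : Measure ℝ).restrict K).prod volume) := by
    refine (h1.integrable (by norm_num)).mul_bdd (c := 1) ?_ ?_
    · exact ((fourier k).continuous.comp continuous_snd).aestronglyMeasurable
    · refine Eventually.of_forall fun p => ?_
      rw [fourier_apply, Circle.norm_coe]
  exact h2.integral_prod_left

theorem mode_ae_zero (f : L2) (k : ℤ)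
    (h : ∀ ψ : ℝ → ℝ, ContDiff ℝ ∞ ψ → HasCompactSupport ψ →
      ∫ p, f p * modeTest ψ k p = 0) :
    ∀ᵐ x : ℝ, ∫ y, f (x, y) * fourier k y = 0 := by
  refine ae_eq_zero_of_integral_contDiff_smul_eq_zero (mode_locallyIntegrable f k) ?_
  intro ψ hψ hc
  have hint : Integrable (fun p : ℝ × AddCircle (2 * Real.pi) => f p * modeTest ψ k p)
      ((volume : Measure ℝ).prod volume) := integrable_mul_test f (isTest_modeTest hψ hc k)
  have h1 : ∫ x : ℝ, ∫ y, f (x, y) * modeTest ψ k (x, y) = 0 :=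
    (integral_prod _ hint).symm.trans (h ψ hψ hc)
  rw [← h1]
  refine integral_congr_ae (Eventually.of_forall fun x => ?_)
  simp only [modeTest, Complex.real_smul]
  rw [← integral_const_mul]
  congr 1
  funext y
  ring

theorem circle_ae_zero {v : AddCircle (2 * Real.pi) → ℂ} (hv : MemLp v 2 volume)
    (h : ∀ k : ℤ, ∫ y, v y * fourier k y = 0) : v =ᵐ[volume] 0 := by
  have hpos : ENNReal.ofReal (2 * Real.pi) ≠ 0 := by
    simp [Real.pi_pos]
  have hvol := AddCircle.volume_eq_smul_haarAddCircle (T := 2 * Real.pi)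
  have hv' : MemLp v 2 (AddCircle.haarAddCircle (T := 2 * Real.pi)) := by
    refine hv.of_measure_le_smul (c := (ENNReal.ofReal (2 * Real.pi))⁻¹) (by simpa using hpos) ?_
    rw [hvol, smul_smul, ENNReal.inv_mul_cancel hpos ENNReal.ofReal_ne_top, one_smul]
  have h0 : hv'.toLp v = 0 := by
    have hr : fourierBasis.repr (hv'.toLp v) = 0 := by
      ext k
      have hk := h (-k)
      rw [hvol, integral_smul_measure] at hk
      have h2 : (ENNReal.ofReal (2 * Real.pi)).toReal ≠ 0 :=
        ENNReal.toReal_ne_zero.mpr ⟨hpos, ENNReal.ofReal_ne_top⟩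
      have hk' := (smul_eq_zero.mp hk).resolve_left h2
      refine (fourierBasis_repr _ k).trans ?_
      show _ = (0 : ℂ)
      rw [← hk', fourierCoeff]
      refine integral_congr_ae ?_
      filter_upwards [hv'.coeFn_toLp] with y hy
      rw [hy, smul_eq_mul, mul_comm]
    exact fourierBasis.repr.map_eq_zero_iff.mp hr
  have h1 := (hv'.toLp_eq_toLp_iff (MemLp.zero' (ε := ℂ))).mp
    (h0.trans (MemLp.toLp_zero MemLp.zero').symm)
  rw [hvol]
  exact (Measure.ae_smul_measure h1 _)

theorem slice_memLp (f : L2) : ∀ᵐ x : ℝ, MemLp (fun y => f (x, y)) 2 volume := by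
  have h1 : Integrable (fun p : ℝ × AddCircle (2 * Real.pi) => ‖f p‖ ^ 2)
      ((volume : Measure ℝ).prod volume) := (Lp.memLp f).integrable_norm_pow (by norm_num)
  have h2 := h1.prod_right_ae
  filter_upwards [h2] with x hx
  refine (memLp_two_iff_integrable_sq_norm ?_).mpr hx
  exact ((Lp.stronglyMeasurable f).comp_measurable measurable_prodMk_left).aestronglyMeasurable

theorem eq_zero_of_test (f : L2) (h : ∀ φ, IsTest φ → ∫ p, f p * φ p = 0) : f = 0 := by
  have h1 : ∀ᵐ x : ℝ, ∀ k : ℤ, ∫ y, f (x, y) * fourier k y = 0 :=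
    ae_all_iff.mpr fun k => mode_ae_zero f k fun ψ hψ hc => h _ (isTest_modeTest hψ hc k)
  have h2 : ∀ᵐ x : ℝ, ∀ᵐ y : AddCircle (2 * Real.pi), f (x, y) = 0 := by
    filter_upwards [h1, slice_memLp f] with x hx hm
    exact circle_ae_zero hm hx
  rw [Lp.eq_zero_iff_ae_eq_zero]
  have hm : MeasurableSet {p : Cyl | f p = 0} :=
    (Lp.stronglyMeasurable f).measurable (measurableSet_singleton 0)
  exact (Measure.ae_prod_iff_ae_ae hm).mpr h2

theorem eq_of_test {f g : L2} (h : ∀ φ, IsTest φ → ∫ p, f p * φ p = ∫ p, g p * φ p) :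
    f = g := by
  rw [← sub_eq_zero, sub_eq_add_neg, ← neg_one_smul ℂ g]
  refine eq_zero_of_test _ fun φ hφ => ?_
  have hg : Integrable (fun p => ((-1 : ℂ) • g : L2) p * φ p) := integrable_mul_test _ hφ
  rw [integral_add_mul _ _ (integrable_mul_test f hφ) hg, integral_smul_mul, h φ hφ]
  ring

/-! ### Helper facts: the operator maps into `L²₀(X)` -/

theorem mem_L20_of_test (w : L2)
    (h : ∀ ψ : ℝ → ℝ, ContDiff ℝ ∞ ψ → HasCompactSupport ψ →
      ∫ p, w p * modeTest ψ 0 p = 0) : w ∈ L20 := by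
  rw [Submodule.mem_orthogonal]
  rintro v ⟨f, hf⟩
  have h0 := mode_ae_zero w 0 h
  rw [L2.inner_def]
  have hint : Integrable (fun p : ℝ × AddCircle (2 * Real.pi) => (starRingEnd ℂ) (f p.1) * w p)
      ((volume : Measure ℝ).prod volume) := by
    refine (L2.integrable_inner (𝕜 := ℂ) v w).congr ?_
    filter_upwards [hf] with p hp
    simp [hp, mul_comm]
  have : ∫ p, inner ℂ (v p) (w p) = ∫ p : Cyl, (starRingEnd ℂ) (f p.1) * w p := by
    refine integral_congr_ae ?_
    filter_upwards [hf] with p hp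
    simp [hp, mul_comm]
  refine (this.trans (integral_prod _ hint)).trans ?_
  refine integral_eq_zero_of_ae ?_
  filter_upwards [h0] with x hx
  simp only [integral_const_mul]
  simp only [fourier_zero, mul_one] at hx
  simp [hx]

theorem integral_mode_zero {u : L2} (hu : u ∈ L20) {ψ : ℝ → ℝ} (hψ : Continuous ψ)
    (hc : HasCompactSupport ψ) : ∫ p, u p * (ψ p.1 : ℂ) = 0 := by
  have hcont : Continuous (fun p : Cyl => (ψ p.1 : ℂ)) := by fun_prop
  have hcs : HasCompactSupport (fun p : Cyl => (ψ p.1 : ℂ)) := by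
    refine HasCompactSupport.intro (K := tsupport ψ ×ˢ Set.univ)
      (hc.isCompact.prod isCompact_univ) fun p hp => ?_
    have : p.1 ∉ tsupport ψ := fun hh => hp ⟨hh, trivial⟩
    simp [image_eq_zero_of_notMem_tsupport this]
  have hm : MemLp (fun p : Cyl => (ψ p.1 : ℂ)) 2 volume :=
    hcont.memLp_of_hasCompactSupport hcs
  have hmem : hm.toLp _ ∈ axial := ⟨fun x => (ψ x : ℂ), hm.coeFn_toLp⟩
  have h0 := Submodule.mem_orthogonal _ _ |>.mp hu _ hmem
  rw [L2.inner_def] at h0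
  rw [← h0]
  refine integral_congr_ae ?_
  filter_upwards [hm.coeFn_toLp] with p hp
  simp [hp, mul_comm]

theorem mem_L20_of_hasWeakDXX {u f : L2} (hu : u ∈ L20) (h : HasWeakDXX u f) : f ∈ L20 := by
  refine mem_L20_of_test f fun ψ hψ hc => ?_
  rw [← h _ (isTest_modeTest hψ hc 0)]
  have hd : Differentiable ℝ ψ := hψ.differentiable (by simp)
  have hψ' : ContDiff ℝ ∞ (deriv ψ) := (contDiff_infty_iff_deriv.mp hψ).2
  have hd' : Differentiable ℝ (deriv ψ) := hψ'.differentiable (by simp)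
  have hψ'' : ContDiff ℝ ∞ (deriv (deriv ψ)) := (contDiff_infty_iff_deriv.mp hψ').2
  have e1 : ∀ χ : ℝ → ℝ, Differentiable ℝ χ →
      dX (modeTest χ 0) = modeTest (deriv χ) 0 := by
    intro χ hχ
    funext p
    simp only [dX, modeTest, fourier_zero, mul_one]
    exact (hχ p.1).hasDerivAt.ofReal_comp.deriv
  rw [e1 ψ hd, e1 _ hd']
  have := integral_mode_zero hu hψ''.continuous hc.deriv.deriv
  simpa [modeTest] using this

theorem mem_L20_of_hasWeakVDYY {V : C(ℝ, ℝ)} {u g : L2} (h : HasWeakVDYY V u g) :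
    g ∈ L20 := by
  refine mem_L20_of_test g fun ψ hψ hc => ?_
  rw [← h _ (isTest_modeTest hψ hc 0)]
  have e1 : dY (modeTest ψ 0) = 0 := by
    funext p
    simp [dY, modeTest]
  have e2 : dY (0 : Cyl → ℂ) = 0 := by
    funext p
    simp [dY]
  rw [e1, e2]
  simp

/-! ### The generalized Baouendi-Grushin operator -/

/-- The domain `D = {u ∈ L²₀(X) : ∂ₓ² u ∈ L²(X), V(x) ∂_y² u ∈ L²(X)}`. -/
def grushinDomain (V : C(ℝ, ℝ)) : Submodule ℂ L20 where
  carrier := {u | (∃ f : L2, HasWeakDXX u f) ∧ ∃ g : L2, HasWeakVDYY V u g}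
  zero_mem' := ⟨⟨0, by simpa using hasWeakDXX_smul 0 (u := 0) (f := 0) (fun φ _ => by
      rw [← zero_smul ℂ (0 : L2), integral_smul_mul, integral_smul_mul]; simp)⟩,
    ⟨0, fun φ _ => by
      show ∫ p, (0 : L2) p * _ = _
      rw [← zero_smul ℂ (0 : L2), integral_smul_mul, integral_smul_mul]; simp⟩⟩
  add_mem' := by
    rintro u v ⟨⟨f, hf⟩, ⟨g, hg⟩⟩ ⟨⟨f', hf'⟩, ⟨g', hg'⟩⟩
    exact ⟨⟨f + f', hasWeakDXX_add hf hf'⟩, ⟨g + g', hasWeakVDYY_add hg hg'⟩⟩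
  smul_mem' := by
    rintro c u ⟨⟨f, hf⟩, ⟨g, hg⟩⟩
    exact ⟨⟨c • f, hasWeakDXX_smul c hf⟩, ⟨c • g, hasWeakVDYY_smul c hg⟩⟩

/-- The operator `P_V = -∂ₓ² - V(x) ∂_y²` on the Hilbert space `L²₀(X)`, with domain
`grushinDomain V`. The chosen weak derivatives are unique, by `eq_of_test`. -/
def grushin (V : C(ℝ, ℝ)) : L20 →ₗ.[ℂ] L20 where
  domain := grushinDomain V
  toFun :=
    { toFun := fun u => ⟨-u.2.1.choose - u.2.2.choose,
        sub_mem (neg_mem (mem_L20_of_hasWeakDXX u.1.2 u.2.1.choose_spec))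
          (mem_L20_of_hasWeakVDYY u.2.2.choose_spec)⟩
      map_add' := by
        intro u v
        have h1 : (u + v).2.1.choose = u.2.1.choose + v.2.1.choose := eq_of_test fun φ hφ => by
          rw [← (u + v).2.1.choose_spec φ hφ,
            ← hasWeakDXX_add u.2.1.choose_spec v.2.1.choose_spec φ hφ]
          rfl
        have h2 : (u + v).2.2.choose = u.2.2.choose + v.2.2.choose := eq_of_test fun φ hφ => by
          rw [← (u + v).2.2.choose_spec φ hφ,
            ← hasWeakVDYY_add u.2.2.choose_spec v.2.2.choose_spec φ hφ]
          rfl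
        ext1
        simp only [h1, h2, Submodule.coe_add]
        abel
      map_smul' := by
        intro c u
        have h1 : (c • u).2.1.choose = c • u.2.1.choose := eq_of_test fun φ hφ => by
          rw [← (c • u).2.1.choose_spec φ hφ, ← hasWeakDXX_smul c u.2.1.choose_spec φ hφ]
          rfl
        have h2 : (c • u).2.2.choose = c • u.2.2.choose := eq_of_test fun φ hφ => by
          rw [← (c • u).2.2.choose_spec φ hφ, ← hasWeakVDYY_smul c u.2.2.choose_spec φ hφ]
          rfl
        ext1
        simp only [h1, h2, RingHom.id_apply, Submodule.coe_smul]
        module }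

/-- The potential `x² + s²`. -/
def potential (s : ℝ) : C(ℝ, ℝ) := ⟨fun x => x ^ 2 + s ^ 2, by fun_prop⟩

/-- The operator `P_s = -∂ₓ² - (x² + s²) ∂_y²` on `L²₀(X)`. -/
def P (s : ℝ) : L20 →ₗ.[ℂ] L20 := grushin (potential s)

/-! ### Eigenvalues and their counting function -/

/-- The eigenspace `{u ∈ dom A : A u = μ u}` of an unbounded operator; `μ` is an eigenvalue when
it is not zero. -/
def eigenspace {H : Type*} [AddCommGroup H] [Module ℂ H] (A : H →ₗ.[ℂ] H) (μ : ℂ) :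
    Submodule ℂ H where
  carrier := {u | ∃ h : u ∈ A.domain, A ⟨u, h⟩ = μ • u}
  zero_mem' := ⟨A.domain.zero_mem, by
    have : (⟨0, A.domain.zero_mem⟩ : A.domain) = 0 := rfl
    rw [this, A.map_zero, smul_zero]⟩
  add_mem' := by
    rintro u v ⟨hu, hu'⟩ ⟨hv, hv'⟩
    refine ⟨A.domain.add_mem hu hv, ?_⟩
    have : (⟨u + v, A.domain.add_mem hu hv⟩ : A.domain) = ⟨u, hu⟩ + ⟨v, hv⟩ := rfl
    rw [this, A.map_add, hu', hv', smul_add]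
  smul_mem' := by
    rintro c u ⟨hu, hu'⟩
    refine ⟨A.domain.smul_mem c hu, ?_⟩
    have : (⟨c • u, A.domain.smul_mem c hu⟩ : A.domain) = c • ⟨u, hu⟩ := rfl
    rw [this, A.map_smul, hu', smul_comm]

/-- The span of all eigenvectors of `A` whose eigenvalue is real and at most `E`. -/
def spectralSubspace {H : Type*} [AddCommGroup H] [Module ℂ H] (A : H →ₗ.[ℂ] H) (E : ℝ) :
    Submodule ℂ H :=
  ⨆ (μ : ℝ) (_ : μ ≤ E), eigenspace A (μ : ℂ)

/-- The eigenvalue counting function: the number of eigenvalues of `A` in `(-∞, E]`, each counted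
as many times as its multiplicity. Eigenspaces of distinct eigenvalues being independent, it is
the dimension of `spectralSubspace A E` (when that is finite). -/
def counting {H : Type*} [AddCommGroup H] [Module ℂ H] (A : H →ₗ.[ℂ] H) (E : ℝ) : ℕ :=
  Module.finrank ℂ (spectralSubspace A E)

end Grushin

end

noncomputable section

namespace Grushin

/-! ### Functions determined by their moments -/

/-! On the Fourier mode `e^{iky}`, `k ≠ 0`, the operator `P_s` acts as the harmonic oscillator `-∂ₓ²
+ k²x²` shifted by the constant `k²s²`. Its eigenvalues are therefore `(2n+1)|k| + k²s²`, with
eigenfunctions a Hermite function of `x` times `e^{iky}`; the mode `k = 0` is excluded by `L²₀(X)`.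

No self-adjointness is needed to see that nothing else occurs. Testing the eigenvalue equation of
`u` against a Hermite mode of another level shows that the two are orthogonal
(`inner_hermiteMode_eq_zero_of_mem_eigenspace`); this requires extending the distributional
identities from compactly supported to Gaussian-decaying test functions. The Hermite modes are
complete in `L²₀(X)` (`eq_zero_of_inner_hermiteMode`), because a function with enough exponential
decay is determined by its moments. Hence `spectralSubspace (P s) E` is the span of the modes of
level at most `E` (`spectralSubspace_P`), and these are linearly independent.

What remains is a lattice point count: `N(E) = 2 ∑_k levelCount s E k`, each term being `E/(2k)` up
to an error of order `1 + k s²` (`counting_P`, `abs_two_mul_levelCount_sub_le`). For `s = 0` the sum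
runs up to `E` and the harmonic series gives `E log E`. For `s ≠ 0` the shift `k²s²` stops the sum
at `k` of order `√E`, which halves the logarithm. -/

/-- Expand the exponential in its power series and integrate term by term; the norms of the terms
add up to `‖F x‖ exp(|a||x|)`, which is integrable by hypothesis. -/
theorem integral_cexp_eq_zero_of_moments {F : ℝ → ℂ} (a : ℝ)
    (hF : Integrable fun x => ‖F x‖ * Real.exp (|a| * |x|)) (hFm : AEStronglyMeasurable F)
    (hmom : ∀ n : ℕ, ∫ x : ℝ, (x : ℂ) ^ n * F x = 0) :
    ∫ x : ℝ, Complex.exp (a * x * Complex.I) * F x = 0 := by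
  have hs := hasSum_integral_of_dominated_convergence (μ := (volume : Measure ℝ))
    (F := fun (n : ℕ) (x : ℝ) => ((a * x * Complex.I) ^ n / (n.factorial : ℂ)) * F x)
    (f := fun x : ℝ => Complex.exp (a * x * Complex.I) * F x)
    (fun n x => ((|a| * |x|) ^ n / n.factorial) * ‖F x‖)
    (fun n => by
      refine AEStronglyMeasurable.mul ?_ hFm
      exact Continuous.aestronglyMeasurable (by fun_prop))
    (fun n => Eventually.of_forall fun x => by simp)
    (Eventually.of_forall fun x => (Real.summable_pow_div_factorial _).mul_right _)
    (by
      refine hF.congr (Eventually.of_forall fun x => ?_)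
      simp only
      rw [tsum_mul_right, Real.exp_eq_exp_ℝ, NormedSpace.exp_eq_tsum_div, mul_comm])
    (Eventually.of_forall fun x => by
      refine HasSum.mul_right _ ?_
      rw [Complex.exp_eq_exp_ℂ]
      exact NormedSpace.expSeries_div_hasSum_exp _)
  have h0 : ∀ n : ℕ, ∫ x : ℝ, ((a * x * Complex.I) ^ n / (n.factorial : ℂ)) * F x = 0 := by
    intro n
    have : (fun x : ℝ => ((a * x * Complex.I) ^ n / (n.factorial : ℂ)) * F x)
        = fun x : ℝ => ((a * Complex.I) ^ n / (n.factorial : ℂ)) * ((x : ℂ) ^ n * F x) := by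
      funext x
      ring
    rw [this, integral_const_mul, hmom, mul_zero]
  simp only [h0] at hs
  exact hs.unique hasSum_zero

/-- By duality: a test function `ψ` is the Fourier transform of the Schwartz function `𝓕⁻ ψ`, and
moving that transform onto `F` gives `∫ ψ F = ∫ (𝓕⁻ ψ) (𝓕 F) = 0`. -/
theorem ae_eq_zero_of_fourier_eq_zero {F : ℝ → ℂ} (hF : Integrable F)
    (h : ∀ t : ℝ, ∫ x : ℝ, Complex.exp (t * x * Complex.I) * F x = 0) : ∀ᵐ x, F x = 0 := by
  refine ae_eq_zero_of_integral_contDiff_smul_eq_zero hF.locallyIntegrable ?_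
  intro ψ hψ hc
  have hc' : HasCompactSupport fun x : ℝ => (ψ x : ℂ) := hc.comp_left (g := Complex.ofReal) rfl
  have hψ' : ContDiff ℝ ∞ fun x : ℝ => (ψ x : ℂ) := Complex.ofRealCLM.contDiff.comp hψ
  set S : SchwartzMap ℝ ℂ := hc'.toSchwartzMap hψ'
  open FourierTransform in
  have key := VectorFourier.integral_fourierIntegral_smul_eq_flip (μ := (volume : Measure ℝ))
    (ν := (volume : Measure ℝ)) (L := innerₗ ℝ) (f := F) (g := (𝓕⁻ S : SchwartzMap ℝ ℂ))
    Real.continuous_fourierChar continuous_inner hF (𝓕⁻ S : SchwartzMap ℝ ℂ).integrable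
  have h1 : ∀ w : ℝ, VectorFourier.fourierIntegral Real.fourierChar volume (innerₗ ℝ) F w = 0 := by
    intro w
    rw [VectorFourier.fourierIntegral, ← h (-2 * Real.pi * w)]
    refine integral_congr_ae (Eventually.of_forall fun x => ?_)
    simp only [Circle.smul_def, smul_eq_mul, Real.fourierChar_apply, innerₗ_apply_apply]
    congr 2
    simp
    ring
  simp only [h1, zero_smul, integral_zero] at key
  rw [key]
  refine integral_congr_ae (Eventually.of_forall fun x => ?_)
  open FourierTransform in
  have h2 : (𝓕 (𝓕⁻ S) : SchwartzMap ℝ ℂ) x = (ψ x : ℂ) := by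
    rw [FourierTransform.fourier_fourierInv_eq]
    rfl
  simp only [Complex.real_smul, smul_eq_mul]
  rw [mul_comm, ← h2, flip_innerₗ]
  congr 1

theorem ae_eq_zero_of_moments {F : ℝ → ℂ}
    (hF : ∀ a : ℝ, Integrable fun x => ‖F x‖ * Real.exp (a * |x|)) (hFm : AEStronglyMeasurable F)
    (hmom : ∀ n : ℕ, ∫ x : ℝ, (x : ℂ) ^ n * F x = 0) : ∀ᵐ x, F x = 0 := by
  refine ae_eq_zero_of_fourier_eq_zero ?_ fun t =>
    integral_cexp_eq_zero_of_moments t (hF |t|) hFm hmom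
  refine (integrable_norm_iff hFm).mp ((hF 0).congr (Eventually.of_forall fun x => by simp))

section

open Polynomial

/-! ### Polynomials times Gaussians -/

/-- The function `p(x) exp (-w x² / 2)`. -/
def gaussPoly (w : ℝ) (p : ℝ[X]) (x : ℝ) : ℝ := p.eval x * Real.exp (-(w / 2) * x ^ 2)

/-- The polynomial factor of the derivative of `gaussPoly w p`. -/
def gaussDeriv (w : ℝ) (p : ℝ[X]) : ℝ[X] := derivative p - C w * X * p

theorem hasDerivAt_gaussPoly (w : ℝ) (p : ℝ[X]) (x : ℝ) :
    HasDerivAt (gaussPoly w p) (gaussPoly w (gaussDeriv w p) x) x := by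
  have h1 : HasDerivAt (fun x : ℝ => Real.exp (-(w / 2) * x ^ 2))
      (Real.exp (-(w / 2) * x ^ 2) * (-(w / 2) * (2 * x))) x := by
    refine HasDerivAt.exp (HasDerivAt.const_mul _ ?_)
    simpa using hasDerivAt_pow 2 x
  convert! (p.hasDerivAt x).mul h1 using 1
  simp only [gaussPoly, gaussDeriv, eval_sub, eval_mul, eval_C, eval_X]
  ring

theorem deriv_gaussPoly (w : ℝ) (p : ℝ[X]) :
    deriv (gaussPoly w p) = gaussPoly w (gaussDeriv w p) :=
  funext fun x => (hasDerivAt_gaussPoly w p x).deriv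

theorem contDiff_gaussPoly (w : ℝ) (p : ℝ[X]) : ContDiff ℝ ∞ (gaussPoly w p) := by
  unfold gaussPoly
  have hp : ContDiff ℝ ∞ fun x => p.eval x := by simpa using p.contDiff_aeval (𝕜 := ℝ) ∞
  exact hp.mul (contDiff_const.mul (contDiff_id.pow 2)).exp

theorem exists_abs_eval_le_mul_exp (p : ℝ[X]) :
    ∃ c : ℝ, ∀ x : ℝ, |p.eval x| ≤ c * Real.exp |x| := by
  induction p using Polynomial.induction_on' with
  | add p q hp hq =>
    obtain ⟨c, hc⟩ := hp
    obtain ⟨d, hd⟩ := hq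
    refine ⟨c + d, fun x => ?_⟩
    rw [eval_add, add_mul]
    exact (abs_add_le _ _).trans (add_le_add (hc x) (hd x))
  | monomial n a =>
    refine ⟨|a| * n.factorial, fun x => ?_⟩
    rw [eval_monomial, abs_mul, abs_pow, mul_assoc]
    gcongr
    have h := Real.pow_div_factorial_le_exp |x| (abs_nonneg x) n
    rw [div_le_iff₀ (by positivity)] at h
    linarith

theorem exists_abs_gaussPoly_mul_exp_le {w : ℝ} (hw : 0 < w) (p : ℝ[X]) (a : ℝ) :
    ∃ c : ℝ, ∀ x : ℝ, |gaussPoly w p x| * Real.exp (a * |x|)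
      ≤ c * Real.exp (-(w / 4) * x ^ 2) := by
  obtain ⟨c, hc⟩ := exists_abs_eval_le_mul_exp p
  have hc0 : 0 ≤ c := by simpa using (abs_nonneg _).trans (hc 0)
  -- The polynomial costs a factor `e^{|x|}`, hence `a + 1`; half of the Gaussian exponent absorbs
  -- the growth, since `(a+1)|x| - (w/4)x² ≤ (a+1)²/w` by completing the square.
  refine ⟨c * Real.exp ((a + 1) ^ 2 / w), fun x => ?_⟩
  rw [gaussPoly, abs_mul, abs_of_pos (Real.exp_pos _)]
  calc _ ≤ c * Real.exp |x| * Real.exp (-(w / 2) * x ^ 2) * Real.exp (a * |x|) := by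
        gcongr
        exact hc x
    _ = c * Real.exp (|x| + -(w / 2) * x ^ 2 + a * |x|) := by
        rw [Real.exp_add, Real.exp_add]
        ring
    _ ≤ c * Real.exp ((a + 1) ^ 2 / w + -(w / 4) * x ^ 2) := by
        refine mul_le_mul_of_nonneg_left (Real.exp_le_exp.mpr ?_) hc0
        have h : 0 ≤ ((a + 1) - w / 2 * |x|) ^ 2 / w := by positivity
        have h2 : ((a + 1) - w / 2 * |x|) ^ 2 / w
            = (a + 1) ^ 2 / w - (a + 1) * |x| + w / 4 * x ^ 2 := by
          rw [← sq_abs x]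
          field_simp
          ring
        linarith
    _ = _ := by
        rw [Real.exp_add]
        ring

theorem memLp_gaussPoly_mul_exp {w : ℝ} (hw : 0 < w) (p : ℝ[X]) (a : ℝ) :
    MemLp (fun x => gaussPoly w p x * Real.exp (a * |x|)) 2 := by
  obtain ⟨c, hc⟩ := exists_abs_gaussPoly_mul_exp_le hw p a
  have h1 : MemLp (fun x : ℝ => c * Real.exp (-(w / 4) * x ^ 2)) 2 := by
    refine MemLp.const_mul ?_ c
    refine (memLp_two_iff_integrable_sq (by fun_prop)).mpr ?_
    refine (integrable_exp_neg_mul_sq (half_pos hw)).congr (Eventually.of_forall fun x => ?_)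
    simp only
    rw [← Real.exp_nat_mul]
    congr 1
    push_cast
    ring
  refine h1.mono' ?_ (Eventually.of_forall fun x => ?_)
  · have := (contDiff_gaussPoly w p).continuous
    exact Continuous.aestronglyMeasurable (by fun_prop)
  · rw [Real.norm_eq_abs, abs_mul, abs_of_pos (Real.exp_pos _)]
    exact hc x

theorem memLp_gaussPoly {w : ℝ} (hw : 0 < w) (p : ℝ[X]) : MemLp (gaussPoly w p) 2 := by
  simpa using memLp_gaussPoly_mul_exp hw p 0

/-! ### Hermite functions -/

/-- The Hermite polynomials of the oscillator `-∂ₓ² + w² x²`. -/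
def hermitePoly (w : ℝ) : ℕ → ℝ[X]
  | 0 => 1
  | n + 1 => C (2 * w) * X * hermitePoly w n - derivative (hermitePoly w n)

theorem hermitePoly_ode (w : ℝ) (n : ℕ) :
    derivative (derivative (hermitePoly w n)) - C (2 * w) * X * derivative (hermitePoly w n)
      + C (2 * w * n) * hermitePoly w n = 0 := by
  induction n with
  | zero => simp [hermitePoly]
  | succ n ih =>
    -- Given the recursion, the equation at `n` amounts to this lowering relation; differentiating
    -- it once more yields the equation at `n + 1`.
    have h1 : derivative (hermitePoly w (n + 1)) = C (2 * w * (n + 1)) * hermitePoly w n := by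
      simp only [hermitePoly, derivative_sub, derivative_mul, derivative_C, derivative_X]
      simp only [map_mul, map_add, C_1] at ih ⊢
      linear_combination -ih
    rw [h1, derivative_mul, derivative_C, hermitePoly]
    simp only [map_mul, map_add, C_1, Nat.cast_add, Nat.cast_one]
    ring

/-- The oscillator equation with the Gaussian factored out: the left side is `p'' - 2wXp' - wp +
w²X²p`, and `hermitePoly_ode` replaces the first two terms by `-2wn p`. -/
theorem gaussDeriv_gaussDeriv_hermitePoly (w : ℝ) (n : ℕ) :
    gaussDeriv w (gaussDeriv w (hermitePoly w n))
      = C w * C w * X ^ 2 * hermitePoly w n - C ((2 * n + 1) * w) * hermitePoly w n := by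
  have h := hermitePoly_ode w n
  simp only [gaussDeriv, derivative_sub, derivative_mul, derivative_C, derivative_X]
  simp only [map_mul, map_add, map_ofNat, C_1] at h ⊢
  linear_combination h

theorem hermitePoly_natDegree_le (w : ℝ) (n : ℕ) :
    (hermitePoly w n).natDegree ≤ n ∧ (hermitePoly w n).coeff n = (2 * w) ^ n := by
  induction n with
  | zero => simp [hermitePoly]
  | succ n ih =>
    have h1 : (derivative (hermitePoly w n)).natDegree < n + 1 :=
      (natDegree_derivative_le _).trans_lt (by omega)
    refine ⟨(natDegree_sub_le _ _).trans (max_le ?_ h1.le), ?_⟩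
    · refine natDegree_mul_le.trans ?_
      have := (natDegree_C_mul_le (2 * w) X).trans natDegree_X_le
      omega
    · rw [hermitePoly, coeff_sub, coeff_eq_zero_of_natDegree_lt h1, mul_assoc, coeff_C_mul,
        coeff_X_mul, ih.2, sub_zero, pow_succ']

theorem hermitePoly_ne_zero {w : ℝ} (hw : w ≠ 0) (n : ℕ) : hermitePoly w n ≠ 0 := by
  intro h
  have := (hermitePoly_natDegree_le w n).2
  rw [h, coeff_zero] at this
  exact pow_ne_zero n (mul_ne_zero two_ne_zero hw) this.symm

/-- Triangularity: the coefficient `(2w)^n` of `X^n` is nonzero, so `X^n` is a combination of the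
`n`-th Hermite polynomial and lower powers. -/
theorem X_pow_mem_span_hermitePoly {w : ℝ} (hw : w ≠ 0) (n : ℕ) :
    (X ^ n : ℝ[X]) ∈ Submodule.span ℝ (Set.range (hermitePoly w)) := by
  induction n using Nat.strong_induction_on with
  | _ n ih =>
    have hdeg := hermitePoly_natDegree_le w n
    have h0 : (2 * w) ^ n ≠ 0 := pow_ne_zero n (mul_ne_zero two_ne_zero hw)
    have h1 := (hermitePoly w n).as_sum_range' (n + 1) (by omega)
    rw [Finset.sum_range_succ, hdeg.2] at h1
    have h2 : (X ^ n : ℝ[X]) = ((2 * w) ^ n)⁻¹ • (hermitePoly w n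
        - ∑ i ∈ Finset.range n, (hermitePoly w n).coeff i • X ^ i) := by
      rw [eq_inv_smul_iff₀ h0, smul_X_eq_monomial, eq_sub_iff_add_eq, add_comm]
      simpa only [smul_X_eq_monomial] using h1.symm
    rw [h2]
    refine Submodule.smul_mem _ _ (Submodule.sub_mem _ (Submodule.subset_span ⟨n, rfl⟩)
      (Submodule.sum_mem _ fun i hi => Submodule.smul_mem _ _ (ih i (Finset.mem_range.mp hi))))

end

/-! ### Square integrable Fourier modes -/

theorem norm_modeTest (h : ℝ → ℝ) (k : ℤ) (p : Cyl) : ‖modeTest h k p‖ = |h p.1| := by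
  rw [modeTest, norm_mul, fourier_apply, Circle.norm_coe, mul_one, Complex.norm_real,
    Real.norm_eq_abs]

theorem aestronglyMeasurable_modeTest {h : ℝ → ℝ} (hh : AEStronglyMeasurable h) (k : ℤ) :
    AEStronglyMeasurable (modeTest h k) (volume : Measure Cyl) := by
  have h1 : AEStronglyMeasurable (fun p : Cyl => h p.1) volume := hh.comp_fst
  exact (Complex.continuous_ofReal.comp_aestronglyMeasurable h1).mul
    ((fourier k).continuous.comp continuous_snd).aestronglyMeasurable

theorem memLp_modeTest {h : ℝ → ℝ} (hh : MemLp h 2) (k : ℤ) :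
    MemLp (modeTest h k) 2 (volume : Measure Cyl) := by
  refine (memLp_two_iff_integrable_sq_norm (aestronglyMeasurable_modeTest hh.1 k)).mpr ?_
  have h1 : Integrable (fun p : ℝ × AddCircle (2 * Real.pi) => h p.1 ^ 2 * (1 : ℝ))
      ((volume : Measure ℝ).prod volume) :=
    ((memLp_two_iff_integrable_sq hh.1).mp hh).mul_prod (integrable_const 1)
  refine h1.congr (Eventually.of_forall fun p => ?_)
  simp only [norm_modeTest, mul_one, sq_abs]

theorem integrable_mul_modeTest (u : L2) {h : ℝ → ℝ} (hh : MemLp h 2) (k : ℤ) :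
    Integrable (fun p => u p * modeTest h k p) :=
  (Lp.memLp u).integrable_mul (memLp_modeTest hh k)

theorem dX_modeTest {h : ℝ → ℝ} (hh : Differentiable ℝ h) (k : ℤ) :
    dX (modeTest h k) = modeTest (deriv h) k := by
  funext p
  simp only [dX, modeTest]
  exact ((hh p.1).hasDerivAt.ofReal_comp.mul_const _).deriv

theorem dY_smul_modeTest (c : ℂ) (h : ℝ → ℝ) (k : ℤ) :
    dY (fun p => c * modeTest h k p) = fun p => (c * (Complex.I * k)) * modeTest h k p := by
  funext p
  obtain ⟨x, y⟩ := p
  induction y using QuotientAddGroup.induction_on with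
  | H y =>
    simp only [dY, modeTest]
    have h1 := (((hasDerivAt_fourier (2 * Real.pi) k y).const_mul ((h x : ℝ) : ℂ)).const_mul c)
    have h2 := (hasDerivAt_fourier (2 * Real.pi) k (y + 0)).comp_const_add y 0
    have h3 := ((h2.const_mul ((h x : ℝ) : ℂ)).const_mul c).deriv
    have e : (fun t : ℝ => c * (((h x : ℝ) : ℂ) * fourier k ((y : AddCircle (2 * Real.pi))
        + (t : AddCircle (2 * Real.pi)))))
        = fun t : ℝ => c * (((h x : ℝ) : ℂ) * fourier k
          ((y + t : ℝ) : AddCircle (2 * Real.pi))) := by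
      funext t
      rw [AddCircle.coe_add]
    refine (congrArg (fun F : ℝ → ℂ => deriv F 0) e).trans (h3.trans ?_)
    have hpi : ((2 * Real.pi : ℝ) : ℂ) ≠ 0 := by exact_mod_cast Real.two_pi_pos.ne'
    rw [add_zero]
    push_cast at hpi ⊢
    field_simp

theorem dY_dY_modeTest (h : ℝ → ℝ) (k : ℤ) :
    dY (dY (modeTest h k)) = fun p => -(k : ℂ) ^ 2 * modeTest h k p := by
  have h1 := dY_smul_modeTest 1 h k
  simp only [one_mul] at h1
  rw [show modeTest h k = fun p => modeTest h k p from rfl, h1, dY_smul_modeTest]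
  funext p
  rw [show Complex.I * k * (Complex.I * k) = (Complex.I * Complex.I) * k ^ 2 by ring,
    Complex.I_mul_I, neg_one_mul]

/-! ### Testing weak derivatives against rapidly decreasing modes -/

theorem tendsto_integral_mul_modeTest (u : L2) (k : ℤ) {g : ℕ → ℝ → ℝ} {g' G : ℝ → ℝ}
    (hg : ∀ n, Continuous (g n)) (hG : MemLp G 2) (hb : ∀ n x, |g n x| ≤ G x)
    (hlim : ∀ x, Tendsto (fun n => g n x) atTop (𝓝 (g' x))) :
    Tendsto (fun n => ∫ p, u p * modeTest (g n) k p) atTop (𝓝 (∫ p, u p * modeTest g' k p)) := by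
  refine tendsto_integral_of_dominated_convergence (fun p => ‖u p * modeTest G k p‖)
    (fun n => ?_) (integrable_mul_modeTest u hG k).norm (fun n => Eventually.of_forall fun p => ?_)
    (Eventually.of_forall fun p => ?_)
  · exact (Lp.aestronglyMeasurable u).mul
      (aestronglyMeasurable_modeTest (hg n).aestronglyMeasurable k)
  · rw [norm_mul, norm_mul, norm_modeTest, norm_modeTest]
    refine mul_le_mul_of_nonneg_left ?_ (norm_nonneg _)
    exact (hb n p.1).trans (le_abs_self _)
  · refine Tendsto.const_mul _ (Tendsto.mul_const _ ?_)
    exact (Complex.continuous_ofReal.tendsto _).comp (hlim p.1)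

/-- Dilates `b(x / (n+1))` of a single bump function: each derivative brings out a factor `1/(n+1) ≤
1`, so the bounds are uniform in `n`. -/
theorem exists_cutoff : ∃ (χ : ℕ → ℝ → ℝ) (c : ℝ), 0 ≤ c ∧ ∀ n, ContDiff ℝ ∞ (χ n) ∧
    HasCompactSupport (χ n) ∧ (∀ x, |χ n x| ≤ c) ∧ (∀ x, |deriv (χ n) x| ≤ c) ∧
    (∀ x, |deriv (deriv (χ n)) x| ≤ c) ∧ ∀ x : ℝ, |x| < n → χ n =ᶠ[𝓝 x] 1 := by
  let b : ContDiffBump (0 : ℝ) := ⟨1, 2, one_pos, one_lt_two⟩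
  have hb : ContDiff ℝ ∞ b := b.contDiff
  have hb' : ContDiff ℝ ∞ (deriv b) := (contDiff_infty_iff_deriv.mp hb).2
  have hb'' : ContDiff ℝ ∞ (deriv (deriv b)) := (contDiff_infty_iff_deriv.mp hb').2
  have hc : HasCompactSupport b := b.hasCompactSupport
  obtain ⟨c₀, h0⟩ := hb.continuous.bounded_above_of_compact_support hc
  obtain ⟨c₁, h1⟩ := hb'.continuous.bounded_above_of_compact_support hc.deriv
  obtain ⟨c₂, h2⟩ := hb''.continuous.bounded_above_of_compact_support hc.deriv.deriv
  have n0 := (norm_nonneg _).trans (h0 0)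
  have n1 := (norm_nonneg _).trans (h1 0)
  have n2 := (norm_nonneg _).trans (h2 0)
  simp only [Real.norm_eq_abs] at h0 h1 h2
  refine ⟨fun n x => b (((n : ℝ) + 1)⁻¹ * x), c₀ + c₁ + c₂, by positivity, fun n => ?_⟩
  set r : ℝ := ((n : ℝ) + 1)⁻¹ with hr
  have hrpos : 0 < r := by positivity
  have hr1 : |r| ≤ 1 := by
    rw [abs_of_pos hrpos]
    exact inv_le_one_of_one_le₀ (by linarith [n.cast_nonneg (α := ℝ)])
  have d1 : deriv (fun x => b (r * x)) = fun x => r * deriv b (r * x) :=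
    funext fun x => by rw [deriv_comp_mul_left, smul_eq_mul]
  have d2 : deriv (deriv (fun x => b (r * x))) = fun x => r * (r * deriv (deriv b) (r * x)) := by
    funext x
    rw [d1, deriv_const_mul_field, deriv_comp_mul_left, smul_eq_mul]
  refine ⟨hb.comp (contDiff_const.mul contDiff_id), ?_, fun x => ?_, fun x => ?_, fun x => ?_,
    fun x hx => ?_⟩
  · exact hc.comp_homeomorph (Homeomorph.mulLeft₀ r hrpos.ne')
  · linarith [h0 (r * x)]
  · rw [d1, abs_mul]
    have := mul_le_mul hr1 (h1 (r * x)) (abs_nonneg _) zero_le_one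
    linarith
  · rw [d2, abs_mul, abs_mul]
    have h3 := mul_le_mul hr1 (h2 (r * x)) (abs_nonneg _) zero_le_one
    have h4 := mul_le_mul hr1 h3 (by positivity) zero_le_one
    linarith
  · have hopen : IsOpen {z : ℝ | |z| < n} := isOpen_lt continuous_abs continuous_const
    filter_upwards [hopen.mem_nhds hx] with z hz
    refine b.one_of_mem_closedBall ?_
    rw [mem_closedBall_zero_iff, Real.norm_eq_abs, abs_mul, abs_of_pos hrpos, hr]
    show ((n : ℝ) + 1)⁻¹ * |z| ≤ 1
    rw [inv_mul_le_iff₀ (by positivity)]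
    have : |z| < n := hz
    linarith

/-- Hermite functions are not compactly supported. They become admissible test functions by applying
the definition to `χ n * h` and letting `n → ∞` under dominated convergence. -/
theorem integral_mul_modeTest_of_hasWeakDXX {u f : L2} (huf : HasWeakDXX u f) {h : ℝ → ℝ}
    (hh : ContDiff ℝ ∞ h) (m0 : MemLp h 2) (m1 : MemLp (deriv h) 2)
    (m2 : MemLp (deriv (deriv h)) 2) (k : ℤ) :
    ∫ p, u p * modeTest (deriv (deriv h)) k p = ∫ p, f p * modeTest h k p := by
  obtain ⟨χ, c, hc0, hχ⟩ := exists_cutoff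
  have hh' : ContDiff ℝ ∞ (deriv h) := (contDiff_infty_iff_deriv.mp hh).2
  have dh : Differentiable ℝ h := hh.differentiable (by simp)
  have dh' : Differentiable ℝ (deriv h) := hh'.differentiable (by simp)
  have hev : ∀ x : ℝ, ∀ᶠ n : ℕ in atTop, χ n * h =ᶠ[𝓝 x] h := by
    intro x
    obtain ⟨N, hN⟩ := exists_nat_gt |x|
    filter_upwards [eventually_ge_atTop N] with n hn
    filter_upwards [(hχ n).2.2.2.2.2 x (hN.trans_le (by exact_mod_cast hn))] with z hz
    simp [hz]
  have hs : ∀ n, ContDiff ℝ ∞ (χ n * h) := fun n => (hχ n).1.mul hh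
  have hs' : ∀ n, ContDiff ℝ ∞ (deriv (χ n * h)) := fun n => (contDiff_infty_iff_deriv.mp (hs n)).2
  have hs'' : ∀ n, ContDiff ℝ ∞ (deriv (deriv (χ n * h))) :=
    fun n => (contDiff_infty_iff_deriv.mp (hs' n)).2
  have lim1 := tendsto_integral_mul_modeTest f k (g := fun n => χ n * h) (g' := h)
    (G := fun x => c * |h x|) (fun n => (hs n).continuous) (m0.abs.const_mul c)
    (fun n x => by
      rw [Pi.mul_apply, abs_mul]
      exact mul_le_mul_of_nonneg_right ((hχ n).2.2.1 x) (abs_nonneg _))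
    (fun x => tendsto_nhds_of_eventually_eq ((hev x).mono fun n hn => hn.eq_of_nhds))
  -- The majorant comes from the Leibniz rule `(χh)'' = χ''h + 2χ'h' + χh''`.
  have lim2 := tendsto_integral_mul_modeTest u k (g := fun n => deriv (deriv (χ n * h)))
    (g' := deriv (deriv h))
    (G := fun x => c * (|h x| + 2 * |deriv h x| + |deriv (deriv h) x|))
    (fun n => (hs'' n).continuous)
    (((m0.abs.add (m1.abs.const_mul 2)).add m2.abs).const_mul c)
    (fun n x => by
      obtain ⟨s0, -, b0, b1, b2, -⟩ := hχ n
      have s1 : ContDiff ℝ ∞ (deriv (χ n)) := (contDiff_infty_iff_deriv.mp s0).2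
      have d0 : Differentiable ℝ (χ n) := s0.differentiable (by simp)
      have d1 : Differentiable ℝ (deriv (χ n)) := s1.differentiable (by simp)
      have e1 : deriv (χ n * h) = deriv (χ n) * h + χ n * deriv h :=
        funext fun z => deriv_mul (d0 z) (dh z)
      have e2 : deriv (deriv (χ n * h)) x = deriv (deriv (χ n)) x * h x
          + 2 * (deriv (χ n) x * deriv h x) + χ n x * deriv (deriv h) x := by
        rw [e1, deriv_add ((d1 x).mul (dh x)) ((d0 x).mul (dh' x)), deriv_mul (d1 x) (dh x),
          deriv_mul (d0 x) (dh' x)]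
        ring
      rw [e2]
      refine (abs_add_three _ _ _).trans ?_
      rw [abs_mul, abs_mul, abs_mul, abs_mul, abs_two, mul_add, mul_add]
      have i0 := mul_le_mul_of_nonneg_right (b2 x) (abs_nonneg (h x))
      have i1 := mul_le_mul_of_nonneg_right (b1 x) (abs_nonneg (deriv h x))
      have i2 := mul_le_mul_of_nonneg_right (b0 x) (abs_nonneg (deriv (deriv h) x))
      linarith)
    (fun x => tendsto_nhds_of_eventually_eq
      ((hev x).mono fun n hn => hn.deriv.deriv.eq_of_nhds))
  refine tendsto_nhds_unique (lim2.congr fun n => ?_) lim1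
  have ht := huf _ (isTest_modeTest (hs n) (hχ n).2.1.mul_right k)
  rwa [dX_modeTest ((hs n).differentiable (by simp)),
    dX_modeTest ((hs' n).differentiable (by simp))] at ht

/-- Same truncation as for `∂ₓ²`, but the cutoff depends on `x` alone and is never differentiated,
so integrability of the derivatives of `h` plays no role. -/
theorem integral_mul_modeTest_of_hasWeakVDYY {V : C(ℝ, ℝ)} {u g : L2} (hug : HasWeakVDYY V u g)
    {h : ℝ → ℝ} (hh : ContDiff ℝ ∞ h) (m0 : MemLp h 2) (m1 : MemLp (fun x => V x * h x) 2)
    (k : ℤ) :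
    -(k : ℂ) ^ 2 * ∫ p, u p * modeTest (fun x => V x * h x) k p
      = ∫ p, g p * modeTest h k p := by
  obtain ⟨χ, c, hc0, hχ⟩ := exists_cutoff
  have hev : ∀ x : ℝ, ∀ᶠ n : ℕ in atTop, χ n x = 1 := by
    intro x
    obtain ⟨N, hN⟩ := exists_nat_gt |x|
    filter_upwards [eventually_ge_atTop N] with n hn
    exact ((hχ n).2.2.2.2.2 x (hN.trans_le (by exact_mod_cast hn))).eq_of_nhds
  have hs : ∀ n, ContDiff ℝ ∞ (χ n * h) := fun n => (hχ n).1.mul hh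
  have lim1 := tendsto_integral_mul_modeTest g k (g := fun n => χ n * h) (g' := h)
    (G := fun x => c * |h x|) (fun n => (hs n).continuous) (m0.abs.const_mul c)
    (fun n x => by
      rw [Pi.mul_apply, abs_mul]
      exact mul_le_mul_of_nonneg_right ((hχ n).2.2.1 x) (abs_nonneg _))
    (fun x => tendsto_nhds_of_eventually_eq ((hev x).mono fun n hn => by simp [hn]))
  have lim2 := tendsto_integral_mul_modeTest u k (g := fun n x => V x * (χ n * h) x)
    (g' := fun x => V x * h x)
    (G := fun x => c * |V x * h x|) (fun n => V.continuous.mul (hs n).continuous)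
    (m1.abs.const_mul c)
    (fun n x => by
      rw [Pi.mul_apply, mul_left_comm, abs_mul]
      exact mul_le_mul_of_nonneg_right ((hχ n).2.2.1 x) (abs_nonneg _))
    (fun x => tendsto_nhds_of_eventually_eq ((hev x).mono fun n hn => by simp [hn]))
  refine tendsto_nhds_unique ((lim2.const_mul _).congr fun n => ?_) lim1
  have ht := hug _ (isTest_modeTest (hs n) (hχ n).2.1.mul_right k)
  rw [← ht, dY_dY_modeTest, ← integral_const_mul]
  refine integral_congr_ae (Eventually.of_forall fun p => ?_)
  simp only [modeTest, Complex.ofReal_mul]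
  ring

/-! ### Weak derivatives of smooth modes -/

theorem integral_mul_deriv_deriv_eq {h ψ : ℝ → ℂ} (hh : ContDiff ℝ ∞ h) (hψ : ContDiff ℝ ∞ ψ)
    (hc : HasCompactSupport ψ) :
    ∫ x, h x * deriv (deriv ψ) x = ∫ x, deriv (deriv h) x * ψ x := by
  have hh' : ContDiff ℝ ∞ (deriv h) := (contDiff_infty_iff_deriv.mp hh).2
  have hh'' : ContDiff ℝ ∞ (deriv (deriv h)) := (contDiff_infty_iff_deriv.mp hh').2
  have hψ' : ContDiff ℝ ∞ (deriv ψ) := (contDiff_infty_iff_deriv.mp hψ).2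
  have hψ'' : ContDiff ℝ ∞ (deriv (deriv ψ)) := (contDiff_infty_iff_deriv.mp hψ').2
  have hd : ∀ {f : ℝ → ℂ}, ContDiff ℝ ∞ f → ∀ x, HasDerivAt f (deriv f x) x :=
    fun hf x => (hf.differentiable (by simp) x).hasDerivAt
  have hi : ∀ {f g : ℝ → ℂ}, ContDiff ℝ ∞ f → ContDiff ℝ ∞ g → HasCompactSupport g →
      Integrable (f * g) := fun hf hg hgc =>
    (hf.continuous.mul hg.continuous).integrable_of_hasCompactSupport hgc.mul_left
  rw [integral_mul_deriv_eq_deriv_mul_of_integrable (fun x _ => hd hh x) (fun x _ => hd hψ' x)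
      (hi hh hψ'' hc.deriv.deriv) (hi hh' hψ' hc.deriv) (hi hh hψ' hc.deriv),
    integral_mul_deriv_eq_deriv_mul_of_integrable (fun x _ => hd hh' x) (fun x _ => hd hψ x)
      (hi hh' hψ' hc.deriv) (hi hh'' hψ hc) (hi hh' hψ hc), neg_neg]

theorem integral_fourier_mul_dY {φ : AddCircle (2 * Real.pi) → ℂ}
    (hφ : ContDiff ℝ 1 fun t : ℝ => φ t) (k : ℤ) :
    ∫ y, fourier k y * deriv (fun t : ℝ => φ (y + (t : AddCircle (2 * Real.pi)))) 0
      = -(Complex.I * k) * ∫ y, fourier k y * φ y := by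
  rw [← AddCircle.intervalIntegral_preimage (2 * Real.pi) 0,
    ← AddCircle.intervalIntegral_preimage (2 * Real.pi) 0]
  have hsh : ∀ y : ℝ, deriv (fun t : ℝ => φ ((y : AddCircle (2 * Real.pi))
      + (t : AddCircle (2 * Real.pi)))) 0 = deriv (fun t : ℝ => φ t) y := by
    intro y
    have h := deriv_comp_const_add (f := fun t : ℝ => φ t) y 0
    rw [add_zero] at h
    rw [← h]
    simp only [AddCircle.coe_add]
  simp only [hsh]
  have hI : ∀ y : ℝ, HasDerivAt (fun y : ℝ => fourier k (y : AddCircle (2 * Real.pi)))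
      ((Complex.I * k) * fourier k (y : AddCircle (2 * Real.pi))) y := by
    intro y
    convert! hasDerivAt_fourier (2 * Real.pi) k y using 1
    have hpi : ((2 * Real.pi : ℝ) : ℂ) ≠ 0 := by exact_mod_cast Real.two_pi_pos.ne'
    push_cast at hpi ⊢
    field_simp
  have hcf : Continuous fun y : ℝ => fourier k (y : AddCircle (2 * Real.pi)) :=
    (fourier k).continuous.comp (AddCircle.continuous_mk' _)
  -- Both endpoints are the same point of the circle, so the boundary terms cancel.
  have hp0 : ((0 + 2 * Real.pi : ℝ) : AddCircle (2 * Real.pi)) = ((0 : ℝ) : AddCircle _) := by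
    rw [zero_add, AddCircle.coe_period, AddCircle.coe_zero]
  rw [intervalIntegral.integral_mul_deriv_eq_deriv_mul (fun y _ => hI y)
    (fun y _ => (hφ.differentiable one_ne_zero y).hasDerivAt)
    ((hcf.const_mul _).intervalIntegrable _ _)
    ((hφ.continuous_deriv le_rfl).intervalIntegrable _ _), hp0, sub_self, zero_sub,
    ← intervalIntegral.integral_const_mul, ← intervalIntegral.integral_neg]
  congr 1
  funext y
  ring

theorem IsTest.contDiff_left {φ : Cyl → ℂ} (hφ : IsTest φ) (y : AddCircle (2 * Real.pi)) :
    ContDiff ℝ ∞ fun x : ℝ => φ (x, y) := by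
  induction y using QuotientAddGroup.induction_on with
  | H y => exact hφ.smooth.comp (contDiff_id.prodMk contDiff_const)

theorem IsTest.contDiff_right {φ : Cyl → ℂ} (hφ : IsTest φ) (x : ℝ) :
    ContDiff ℝ ∞ fun t : ℝ => φ (x, (t : AddCircle (2 * Real.pi))) :=
  hφ.smooth.comp (contDiff_const.prodMk contDiff_id)

theorem IsTest.hasCompactSupport_left {φ : Cyl → ℂ} (hφ : IsTest φ)
    (y : AddCircle (2 * Real.pi)) : HasCompactSupport fun x : ℝ => φ (x, y) := by
  refine HasCompactSupport.intro (K := Prod.fst '' tsupport φ)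
    (hφ.compact.isCompact.image continuous_fst) fun x hx => ?_
  exact image_eq_zero_of_notMem_tsupport fun h => hx ⟨(x, y), h, rfl⟩

theorem integral_toLp_mul {v : Cyl → ℂ} (hv : MemLp v 2 volume) (ψ : Cyl → ℂ) :
    ∫ p, hv.toLp v p * ψ p = ∫ p, v p * ψ p := by
  refine integral_congr_ae ?_
  filter_upwards [hv.coeFn_toLp] with p hp
  rw [hp]

theorem hasWeakDXX_modeTest {h : ℝ → ℝ} (hh : ContDiff ℝ ∞ h) (m0 : MemLp h 2)
    (m2 : MemLp (deriv (deriv h)) 2) (k : ℤ) :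
    HasWeakDXX ((memLp_modeTest m0 k).toLp _) ((memLp_modeTest m2 k).toLp _) := by
  intro φ hφ
  have hφ'' := isTest_dX (isTest_dX hφ)
  have i1 : Integrable (fun p : ℝ × AddCircle (2 * Real.pi) => modeTest h k p * dX (dX φ) p)
      ((volume : Measure ℝ).prod volume) := (memLp_modeTest m0 k).integrable_mul
    ((isTest_continuous hφ'').memLp_of_hasCompactSupport (p := 2) hφ''.compact)
  have i2 : Integrable (fun p : ℝ × AddCircle (2 * Real.pi) =>
      modeTest (deriv (deriv h)) k p * φ p)
      ((volume : Measure ℝ).prod volume) := (memLp_modeTest m2 k).integrable_mul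
    ((isTest_continuous hφ).memLp_of_hasCompactSupport (p := 2) hφ.compact)
  rw [integral_toLp_mul, integral_toLp_mul]
  refine (integral_prod_symm _ i1).trans (Eq.trans ?_ (integral_prod_symm _ i2).symm)
  refine integral_congr_ae (Eventually.of_forall fun y => ?_)
  have hhc : ContDiff ℝ ∞ fun x => (h x : ℂ) := Complex.ofRealCLM.contDiff.comp hh
  have hh' : ContDiff ℝ ∞ (deriv h) := (contDiff_infty_iff_deriv.mp hh).2
  have e1 : deriv (fun x => (h x : ℂ)) = fun x => ((deriv h x : ℝ) : ℂ) :=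
    funext fun x => (hh.differentiable (by simp) x).hasDerivAt.ofReal_comp.deriv
  have e2 : deriv (fun x => ((deriv h x : ℝ) : ℂ)) = fun x => ((deriv (deriv h) x : ℝ) : ℂ) :=
    funext fun x => (hh'.differentiable (by simp) x).hasDerivAt.ofReal_comp.deriv
  have key := integral_mul_deriv_deriv_eq hhc (hφ.contDiff_left y) (hφ.hasCompactSupport_left y)
  rw [e1, e2] at key
  simp only [modeTest, dX, mul_right_comm _ (fourier k y)]
  rw [integral_mul_const, integral_mul_const]
  exact congrArg (· * fourier k y) key

/-- Integrating over `y` first, two integrations by parts on the circle produce `(-ik)² = -k²`; `V`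
is constant on each circle and need not be differentiable. -/
theorem hasWeakVDYY_modeTest {V : C(ℝ, ℝ)} {h : ℝ → ℝ} (m0 : MemLp h 2)
    (k : ℤ) (m1 : MemLp (fun x => -(k : ℝ) ^ 2 * (V x * h x)) 2) :
    HasWeakVDYY V ((memLp_modeTest m0 k).toLp _) ((memLp_modeTest m1 k).toLp _) := by
  intro φ hφ
  have hφ' := isTest_dY hφ
  have hφ'' := isTest_dY hφ'
  have hcV : Continuous fun p : Cyl => (V p.1 : ℂ) * dY (dY φ) p :=
    ((Complex.continuous_ofReal.comp V.continuous).comp continuous_fst).mul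
      (isTest_continuous hφ'')
  have i1 : Integrable (fun p : ℝ × AddCircle (2 * Real.pi) =>
      modeTest h k p * ((V p.1 : ℂ) * dY (dY φ) p))
      ((volume : Measure ℝ).prod volume) := (memLp_modeTest m0 k).integrable_mul
    (hcV.memLp_of_hasCompactSupport (p := 2) hφ''.compact.mul_left)
  have i2 : Integrable (fun p : ℝ × AddCircle (2 * Real.pi) =>
      modeTest (fun x => -(k : ℝ) ^ 2 * (V x * h x)) k p * φ p)
      ((volume : Measure ℝ).prod volume) := (memLp_modeTest m1 k).integrable_mul
    ((isTest_continuous hφ).memLp_of_hasCompactSupport (p := 2) hφ.compact)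
  rw [integral_toLp_mul, integral_toLp_mul]
  refine (integral_prod _ i1).trans (Eq.trans ?_ (integral_prod _ i2).symm)
  refine integral_congr_ae (Eventually.of_forall fun x => ?_)
  have k1 := integral_fourier_mul_dY (φ := fun y => dY φ (x, y))
    ((hφ'.contDiff_right x).of_le (by exact_mod_cast le_top)) k
  have k2 := integral_fourier_mul_dY (φ := fun y => φ (x, y))
    ((hφ.contDiff_right x).of_le (by exact_mod_cast le_top)) k
  have k3 : ∫ y, fourier k y * dY (dY φ) (x, y) = -(k : ℂ) ^ 2 * ∫ y, fourier k y * φ (x, y) := by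
    refine k1.trans ((congrArg (-(Complex.I * k) * ·) k2).trans ?_)
    rw [← mul_assoc, show -(Complex.I * k) * -(Complex.I * k) = (Complex.I * Complex.I) * k ^ 2
      by ring, Complex.I_mul_I, neg_one_mul]
  have e1 : ∀ y : AddCircle (2 * Real.pi), modeTest h k (x, y) * ((V x : ℂ) * dY (dY φ) (x, y))
      = (h x * V x : ℂ) * (fourier k y * dY (dY φ) (x, y)) := fun y => by
    simp only [modeTest]
    ring
  have e2 : ∀ y : AddCircle (2 * Real.pi),
      modeTest (fun x => -(k : ℝ) ^ 2 * (V x * h x)) k (x, y) * φ (x, y)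
      = (-(k : ℂ) ^ 2 * (h x * V x)) * (fourier k y * φ (x, y)) := fun y => by
    simp only [modeTest]
    push_cast
    ring
  simp only [e1, e2]
  rw [integral_const_mul, integral_const_mul, k3]
  ring

theorem integral_modeTest_mul_modeTest {f g : ℝ → ℝ} {j k : ℤ} (hjk : j + k ≠ 0) :
    ∫ p, modeTest f j p * modeTest g k p = 0 := by
  have h1 : (fun p => modeTest f j p * modeTest g k p)
      = fun p : ℝ × AddCircle (2 * Real.pi) => ((f p.1 * g p.1 : ℝ) : ℂ) * fourier (j + k) p.2 := by
    funext p
    simp only [modeTest]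
    rw [fourier_add]
    push_cast
    ring
  have h2 := integral_prod_mul (μ := (volume : Measure ℝ))
    (ν := (volume : Measure (AddCircle (2 * Real.pi))))
    (fun x : ℝ => ((f x * g x : ℝ) : ℂ)) (fun y => fourier (j + k) y)
  rw [h1]
  refine h2.trans ?_
  -- Integration by parts against the constant `1` reads `0 = -i(j+k) ∫ e^{i(j+k)y}`.
  have h3 := integral_fourier_mul_dY (φ := fun _ => 1) contDiff_const (j + k)
  simp only [deriv_const, mul_zero, integral_zero, mul_one] at h3
  have h4 : -(Complex.I * ((j + k : ℤ) : ℂ)) ≠ 0 := by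
    rw [neg_ne_zero]
    exact mul_ne_zero Complex.I_ne_zero (by exact_mod_cast hjk)
  rw [(mul_eq_zero.mp h3.symm).resolve_left h4, mul_zero]

theorem modeTest_toLp_mem_L20 {h : ℝ → ℝ} (m0 : MemLp h 2) {k : ℤ} (hk : k ≠ 0) :
    (memLp_modeTest m0 k).toLp _ ∈ L20 := by
  refine mem_L20_of_test _ fun ψ hψ hc => ?_
  rw [integral_toLp_mul]
  exact integral_modeTest_mul_modeTest (by simpa using hk)

/-- The inner product conjugates its first argument; as `h` is real, this only reverses the
frequency. -/
theorem inner_modeTest_toLp {h : ℝ → ℝ} (m0 : MemLp h 2) (k : ℤ) (u : L2) :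
    inner ℂ ((memLp_modeTest m0 k).toLp _ : L2) u = ∫ p, u p * modeTest h (-k) p := by
  rw [L2.inner_def]
  refine integral_congr_ae ?_
  filter_upwards [(memLp_modeTest m0 k).coeFn_toLp] with p hp
  rw [hp, RCLike.inner_apply, modeTest, modeTest, map_mul, fourier_neg]
  simp

/-! ### The lattice point count -/

theorem abs_harmonic_floor_sub_log_le {y : ℝ} (hy : 1 ≤ y) :
    |∑ k ∈ Finset.Icc 1 ⌊y⌋₊, (k : ℝ)⁻¹ - Real.log y| ≤ 1 := by
  have h1 := log_le_harmonic_floor y (by linarith)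
  have h2 := harmonic_floor_le_one_add_log y hy
  rw [harmonic_eq_sum_Icc] at h1 h2
  push_cast at h1 h2
  rw [abs_le]
  constructor <;> linarith

/-- The number of `n : ℕ` with `(2 n + 1) k + k² s² ≤ E`. -/
def levelCount (s E : ℝ) (k : ℕ) : ℕ := ⌊(E / k - k * s ^ 2 + 1) / 2⌋₊

theorem lt_levelCount_iff {s E : ℝ} {k : ℕ} (hk : 1 ≤ k) (n : ℕ) :
    n < levelCount s E k ↔ (2 * n + 1) * (k : ℝ) + k ^ 2 * s ^ 2 ≤ E := by
  have hk' : (0 : ℝ) < k := by exact_mod_cast hk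
  -- Since `n + 1 ≠ 0`, the comparison with the floor holds whatever the sign of its argument.
  rw [levelCount, ← Nat.add_one_le_iff, Nat.le_floor_iff' (by omega), le_div_iff₀ two_pos]
  push_cast
  rw [← sub_nonneg, ← sub_nonneg (a := E)]
  have : E - ((2 * n + 1) * (k : ℝ) + k ^ 2 * s ^ 2)
      = k * (E / k - k * s ^ 2 + 1 - (n + 1) * 2) := by
    field_simp
    ring
  rw [this, mul_nonneg_iff_of_pos_left hk']

theorem abs_two_mul_levelCount_sub_le {s E : ℝ} (hE : 0 ≤ E) (k : ℕ) :
    |2 * (levelCount s E k : ℝ) - E * (k : ℝ)⁻¹| ≤ k * s ^ 2 + 1 := by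
  have h0 : 0 ≤ E * (k : ℝ)⁻¹ := by positivity
  have h1 : 0 ≤ k * s ^ 2 := by positivity
  have h2 := Nat.lt_floor_add_one ((E / k - k * s ^ 2 + 1) / 2)
  have h3 : (levelCount s E k : ℝ) ≤ (E * (k : ℝ)⁻¹ + 1) / 2 := by
    -- A negative argument has floor `0`, and then the bound rests on `E ≥ 0`.
    rcases le_total 0 ((E / k - k * s ^ 2 + 1) / 2) with h | h
    · refine (Nat.floor_le h).trans ?_
      rw [div_eq_mul_inv E]
      linarith
    · rw [levelCount, Nat.floor_of_nonpos h]
      simp only [Nat.cast_zero]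
      positivity
  rw [levelCount] at *
  rw [div_eq_mul_inv E] at *
  rw [abs_le]
  constructor <;> linarith

/-- The cut `y` is left free: `y = E` serves `s = 0`, and `y = √E` serves `s ≠ 0`, where the error
`y² s²` is still `O(E)`. -/
theorem abs_sum_levelCount_sub_le {s E y : ℝ} (hE : 0 ≤ E) (hy : 1 ≤ y) :
    |2 * ∑ k ∈ Finset.Icc 1 ⌊y⌋₊, (levelCount s E k : ℝ) - E * Real.log y|
      ≤ y * (y * s ^ 2 + 1) + E := by
  have h1 : |∑ k ∈ Finset.Icc 1 ⌊y⌋₊, (2 * (levelCount s E k : ℝ) - E * (k : ℝ)⁻¹)|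
      ≤ y * (y * s ^ 2 + 1) := by
    refine (Finset.abs_sum_le_sum_abs _ _).trans ?_
    refine (Finset.sum_le_card_nsmul _ _ (y * s ^ 2 + 1) fun k hk => ?_).trans ?_
    · refine (abs_two_mul_levelCount_sub_le hE k).trans ?_
      have : (k : ℝ) ≤ y :=
        (Nat.cast_le.mpr (Finset.mem_Icc.mp hk).2).trans (Nat.floor_le (by linarith))
      gcongr
    · rw [nsmul_eq_mul, Nat.card_Icc, Nat.add_sub_cancel]
      gcongr
      exact Nat.floor_le (by linarith)
  have h2 : |E * (∑ k ∈ Finset.Icc 1 ⌊y⌋₊, (k : ℝ)⁻¹ - Real.log y)| ≤ E := by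
    rw [abs_mul, abs_of_nonneg hE]
    exact mul_le_of_le_one_right hE (abs_harmonic_floor_sub_log_le hy)
  have h3 : 2 * ∑ k ∈ Finset.Icc 1 ⌊y⌋₊, (levelCount s E k : ℝ) - E * Real.log y
      = ∑ k ∈ Finset.Icc 1 ⌊y⌋₊, (2 * (levelCount s E k : ℝ) - E * (k : ℝ)⁻¹)
        + E * (∑ k ∈ Finset.Icc 1 ⌊y⌋₊, (k : ℝ)⁻¹ - Real.log y) := by
    rw [Finset.sum_sub_distrib, ← Finset.mul_sum, ← Finset.mul_sum]
    ring
  rw [h3]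
  exact (abs_add_le _ _).trans (add_le_add h1 h2)

theorem sum_levelCount_zero_isBigO :
    (fun E : ℝ => 2 * ∑ k ∈ Finset.Icc 1 ⌊E⌋₊, (levelCount 0 E k : ℝ) - E * Real.log E)
      =O[atTop] (fun E : ℝ => E) := by
  refine IsBigO.of_bound 2 ?_
  filter_upwards [eventually_ge_atTop 1] with E hE
  have := abs_sum_levelCount_sub_le (s := 0) (E := E) (by linarith) hE
  rw [Real.norm_eq_abs, Real.norm_eq_abs, abs_of_nonneg (by linarith : 0 ≤ E)]
  linarith

/-- For `k > √E` one has `E/k ≤ √E`, so each term is at most `√E`, and it vanishes unless `k s² ≤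
√E`. At most `√E / s²` terms survive. -/
theorem sum_levelCount_tail_le {s E : ℝ} (hs : s ≠ 0) (hE : 1 ≤ E) :
    2 * ∑ k ∈ Finset.Ioc ⌊√E⌋₊ ⌊E⌋₊, (levelCount s E k : ℝ) ≤ 2 / s ^ 2 * E := by
  have hr : 1 ≤ √E := Real.one_le_sqrt.mpr hE
  have hsq : √E * √E = E := Real.mul_self_sqrt (by linarith)
  have hs2 : 0 < s ^ 2 := by positivity
  have hbig : ∀ k ∈ Finset.Ioc ⌊√E⌋₊ ⌊E⌋₊, √E < k := fun k hk =>
    Nat.lt_of_floor_lt (Finset.mem_Ioc.mp hk).1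
  have hdiv : ∀ k ∈ Finset.Ioc ⌊√E⌋₊ ⌊E⌋₊, E / k ≤ √E := by
    intro k hk
    have := hbig k hk
    rw [div_le_iff₀ (by linarith)]
    nlinarith
  have hle : ∀ k ∈ Finset.Ioc ⌊√E⌋₊ ⌊E⌋₊, (levelCount s E k : ℝ) ≤ √E := by
    intro k hk
    have h1 := hdiv k hk
    have h2 : 0 ≤ k * s ^ 2 := by positivity
    refine (Nat.cast_le.mpr (Nat.floor_le_floor
      (show (E / k - k * s ^ 2 + 1) / 2 ≤ √E by linarith))).trans (Nat.floor_le (by linarith))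
  have hne : ∀ k ∈ Finset.Ioc ⌊√E⌋₊ ⌊E⌋₊, (levelCount s E k : ℝ) ≠ 0 → k ≤ ⌊√E / s ^ 2⌋₊ := by
    intro k hk h0
    have h1 := hdiv k hk
    have h2 := (Nat.floor_pos.mp (Nat.pos_of_ne_zero (Nat.cast_ne_zero.mp h0)))
    refine Nat.le_floor ?_
    rw [le_div_iff₀ hs2]
    linarith
  rw [← Finset.sum_filter_of_ne hne]
  have hcard : ((Finset.Ioc ⌊√E⌋₊ ⌊E⌋₊).filter fun k => k ≤ ⌊√E / s ^ 2⌋₊).card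
      ≤ ⌊√E / s ^ 2⌋₊ := by
    refine (Finset.card_le_card (t := Finset.Icc 1 ⌊√E / s ^ 2⌋₊) fun k hk => ?_).trans (by simp)
    simp only [Finset.mem_filter, Finset.mem_Ioc] at hk
    exact Finset.mem_Icc.mpr ⟨by omega, hk.2⟩
  have hsum := Finset.sum_le_card_nsmul
    ((Finset.Ioc ⌊√E⌋₊ ⌊E⌋₊).filter fun k => k ≤ ⌊√E / s ^ 2⌋₊) _ √E
    fun k hk => hle k (Finset.mem_filter.mp hk).1
  rw [nsmul_eq_mul] at hsum
  calc _ ≤ 2 * (√E / s ^ 2 * √E) := by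
        gcongr
        refine hsum.trans ?_
        gcongr
        exact (Nat.cast_le.mpr hcard).trans (Nat.floor_le (by positivity))
    _ = 2 / s ^ 2 * (√E * √E) := by ring
    _ = _ := by rw [hsq]

theorem sum_levelCount_isBigO {s : ℝ} (hs : s ≠ 0) :
    (fun E : ℝ => 2 * ∑ k ∈ Finset.Icc 1 ⌊E⌋₊, (levelCount s E k : ℝ) - E * Real.log √E)
      =O[atTop] (fun E : ℝ => E) := by
  -- The head up to `√E` contributes `s²E + √E + E ≤ (s² + 2)E`, the tail `(2/s²)E`.
  refine IsBigO.of_bound (s ^ 2 + 2 + 2 / s ^ 2) ?_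
  filter_upwards [eventually_ge_atTop 1] with E hE
  have hr : 1 ≤ √E := Real.one_le_sqrt.mpr hE
  have hsq : √E * √E = E := Real.mul_self_sqrt (by linarith)
  have h1 := abs_sum_levelCount_sub_le (s := s) (E := E) (by linarith) hr
  have h2 := sum_levelCount_tail_le hs hE
  have h3 : 0 ≤ ∑ k ∈ Finset.Ioc ⌊√E⌋₊ ⌊E⌋₊, (levelCount s E k : ℝ) := by positivity
  have h4 : ⌊√E⌋₊ ≤ ⌊E⌋₊ := Nat.floor_le_floor (by nlinarith)
  have h5 := Finset.sum_Ioc_consecutive (fun k => (levelCount s E k : ℝ)) (Nat.zero_le _) h4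
  rw [← Finset.Icc_add_one_left_eq_Ioc, ← Finset.Icc_add_one_left_eq_Ioc 0] at h5
  simp only [zero_add] at h5
  have h6 : √E ≤ E := by nlinarith
  have h7 : √E * (√E * s ^ 2 + 1) = s ^ 2 * E + √E := by rw [← hsq]; simp; ring
  rw [Real.norm_eq_abs, Real.norm_eq_abs, abs_of_nonneg (by linarith : 0 ≤ E), ← h5]
  rw [abs_le] at h1 ⊢
  have h8 : 0 ≤ 2 / s ^ 2 * E := by positivity
  constructor <;> linarith

/-! ### Eigenfunctions -/

/-- Frees the eigenvalue equation from the chosen weak derivatives: they are unique, so any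
witnesses will do. -/
theorem mem_eigenspace_P_iff {s : ℝ} {μ : ℂ} {u : L20} :
    u ∈ eigenspace (P s) μ ↔ ∃ f g : L2, HasWeakDXX u f ∧ HasWeakVDYY (potential s) u g ∧
      -f - g = μ • (u : L2) := by
  constructor
  · rintro ⟨hu, h⟩
    exact ⟨_, _, hu.1.choose_spec, hu.2.choose_spec, congrArg Subtype.val h⟩
  · rintro ⟨f, g, hf, hg, h⟩
    have hu : u ∈ (P s).domain := ⟨⟨f, hf⟩, ⟨g, hg⟩⟩
    refine ⟨hu, Subtype.ext ?_⟩
    have e1 : hu.1.choose = f := eq_of_test fun φ hφ => by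
      rw [← hu.1.choose_spec φ hφ, ← hf φ hφ]
    have e2 : hu.2.choose = g := eq_of_test fun φ hφ => by
      rw [← hu.2.choose_spec φ hφ, ← hg φ hφ]
    refine Eq.trans ?_ h
    show -hu.1.choose - hu.2.choose = _
    rw [e1, e2]

/-- The indices `(n, k)` of the eigenfunctions, `k` being the frequency on the circle. -/
abbrev Idx : Type := ℕ × {k : ℤ // k ≠ 0}

theorem abs_frequency_pos (i : Idx) : 0 < |((i.2 : ℤ) : ℝ)| :=
  abs_pos.mpr (Int.cast_ne_zero.mpr i.2.2)

/-- The Hermite function of degree `n` of the oscillator `-∂ₓ² + k² x²`. -/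
def hermiteFun (i : Idx) : ℝ → ℝ :=
  gaussPoly |((i.2 : ℤ) : ℝ)| (hermitePoly |((i.2 : ℤ) : ℝ)| i.1)

theorem memLp_hermiteFun (i : Idx) : MemLp (hermiteFun i) 2 :=
  memLp_gaussPoly (abs_frequency_pos i) _

theorem contDiff_hermiteFun (i : Idx) : ContDiff ℝ ∞ (hermiteFun i) :=
  contDiff_gaussPoly _ _

theorem memLp_deriv_hermiteFun (i : Idx) : MemLp (deriv (hermiteFun i)) 2 := by
  rw [hermiteFun, deriv_gaussPoly]
  exact memLp_gaussPoly (abs_frequency_pos i) _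

theorem memLp_deriv_deriv_hermiteFun (i : Idx) : MemLp (deriv (deriv (hermiteFun i))) 2 := by
  rw [hermiteFun, deriv_gaussPoly, deriv_gaussPoly]
  exact memLp_gaussPoly (abs_frequency_pos i) _

theorem memLp_potential_mul_hermiteFun (s : ℝ) (i : Idx) :
    MemLp (fun x => potential s x * hermiteFun i x) 2 := by
  have h := memLp_gaussPoly (abs_frequency_pos i)
    ((Polynomial.X ^ 2 + Polynomial.C (s ^ 2)) * hermitePoly |((i.2 : ℤ) : ℝ)| i.1)
  refine h.congr_norm ?_ (Eventually.of_forall fun x => ?_)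
  · exact ((potential s).continuous.mul (contDiff_hermiteFun i).continuous).aestronglyMeasurable
  · simp [gaussPoly, hermiteFun, potential, mul_assoc]

/-- The eigenvalues `(2 n + 1) |k| + k² s²` of `P s`. -/
def level (s : ℝ) (i : Idx) : ℝ :=
  (2 * i.1 + 1) * |((i.2 : ℤ) : ℝ)| + ((i.2 : ℤ) : ℝ) ^ 2 * s ^ 2

/-- The parameter `s` only adds the constant `k²s²` to the oscillator `-∂ₓ² + k²x²`, so the same
function serves every `s`. -/
theorem deriv_deriv_hermiteFun (s : ℝ) (i : Idx) (x : ℝ) :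
    deriv (deriv (hermiteFun i)) x
      = ((i.2 : ℤ) : ℝ) ^ 2 * (potential s x * hermiteFun i x) - level s i * hermiteFun i x := by
  rw [hermiteFun, deriv_gaussPoly, deriv_gaussPoly, gaussDeriv_gaussDeriv_hermitePoly]
  simp only [gaussPoly, level, potential, ContinuousMap.coe_mk, Polynomial.eval_sub,
    Polynomial.eval_mul, Polynomial.eval_C, Polynomial.eval_pow, Polynomial.eval_X]
  rw [abs_mul_abs_self]
  ring

/-- The eigenfunctions of `P s`. -/
def hermiteMode (i : Idx) : L20 :=
  ⟨(memLp_modeTest (memLp_hermiteFun i) i.2).toLp _,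
    modeTest_toLp_mem_L20 (memLp_hermiteFun i) i.2.2⟩

theorem hermiteMode_mem_eigenspace (s : ℝ) (i : Idx) :
    hermiteMode i ∈ eigenspace (P s) (level s i : ℂ) := by
  have m1 := (memLp_potential_mul_hermiteFun s i).const_mul (-((i.2 : ℤ) : ℝ) ^ 2)
  refine mem_eigenspace_P_iff.mpr ⟨_, _, hasWeakDXX_modeTest (contDiff_hermiteFun i)
    (memLp_hermiteFun i) (memLp_deriv_deriv_hermiteFun i) i.2,
    hasWeakVDYY_modeTest (memLp_hermiteFun i) i.2 m1, ?_⟩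
  simp only [hermiteMode]
  rw [← MemLp.toLp_neg, ← MemLp.toLp_sub, ← MemLp.toLp_const_smul]
  refine MemLp.toLp_congr _ _ (Eventually.of_forall fun p => ?_)
  simp only [Pi.sub_apply, Pi.neg_apply, Pi.smul_apply, modeTest, deriv_deriv_hermiteFun s]
  rw [smul_eq_mul]
  push_cast
  ring

theorem inner_hermiteMode (i : Idx) (u : L20) :
    inner ℂ (hermiteMode i) u = ∫ p, (u : L2) p * modeTest (hermiteFun i) (-i.2) p :=
  inner_modeTest_toLp (memLp_hermiteFun i) _ _

/-- Symmetry of `P s` in weak form: pairing `P u = μ u` with a Hermite mode and moving the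
derivatives onto the mode gives `(level s i - μ) ⟨hermiteMode i, u⟩ = 0`. -/
theorem inner_hermiteMode_eq_zero_of_mem_eigenspace {s μ : ℝ} {u : L20}
    (hu : u ∈ eigenspace (P s) (μ : ℂ)) {i : Idx} (hi : level s i ≠ μ) :
    inner ℂ (hermiteMode i) u = 0 := by
  obtain ⟨f, g, hf, hg, h⟩ := mem_eigenspace_P_iff.mp hu
  have t1 := integral_mul_modeTest_of_hasWeakDXX hf (contDiff_hermiteFun i) (memLp_hermiteFun i)
    (memLp_deriv_hermiteFun i) (memLp_deriv_deriv_hermiteFun i) (-i.2)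
  have t2 := integral_mul_modeTest_of_hasWeakVDYY hg (contDiff_hermiteFun i) (memLp_hermiteFun i)
    (memLp_potential_mul_hermiteFun s i) (-i.2)
  have t3 := integral_add_mul f g (integrable_mul_modeTest f (memLp_hermiteFun i) (-i.2))
    (integrable_mul_modeTest g (memLp_hermiteFun i) (-i.2))
  have hfg : f + g = (-(μ : ℂ)) • (u : L2) := by
    rw [neg_smul, ← h]
    abel
  rw [hfg, integral_smul_mul, ← t1, ← t2] at t3
  have t4 : ∫ p, (u : L2) p * modeTest (deriv (deriv (hermiteFun i))) (-i.2) p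
      = ((i.2 : ℤ) : ℂ) ^ 2 * (∫ p, (u : L2) p
          * modeTest (fun x => potential s x * hermiteFun i x) (-i.2) p)
        - level s i * ∫ p, (u : L2) p * modeTest (hermiteFun i) (-i.2) p := by
    rw [← integral_const_mul, ← integral_const_mul, ← integral_sub
      ((integrable_mul_modeTest _ (memLp_potential_mul_hermiteFun s i) _).const_mul _)
      ((integrable_mul_modeTest _ (memLp_hermiteFun i) _).const_mul _)]
    refine integral_congr_ae (Eventually.of_forall fun p => ?_)
    simp only [modeTest, deriv_deriv_hermiteFun s]
    push_cast
    ring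
  rw [t4] at t3
  rw [inner_hermiteMode]
  have hne : (level s i : ℂ) - μ ≠ 0 := sub_ne_zero.mpr (by exact_mod_cast hi)
  refine (mul_eq_zero.mp ?_).resolve_left hne
  push_cast at t3
  linear_combination t3

theorem inner_hermiteMode_hermiteMode {i j : Idx} (hij : i ≠ j) :
    inner ℂ (hermiteMode i) (hermiteMode j) = 0 := by
  by_cases hk : i.2 = j.2
  -- The modes do not depend on `s`, so `s = 0` may be used: at equal frequency the levels
  -- `(2n+1)|k|` separate the degrees. Distinct frequencies are orthogonal on the circle.
  · refine inner_hermiteMode_eq_zero_of_mem_eigenspace (hermiteMode_mem_eigenspace 0 j) ?_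
    have hn : i.1 ≠ j.1 := fun h => hij (Prod.ext h hk)
    intro h
    simp only [level, hk] at h
    have h2 := mul_right_cancel₀ (abs_frequency_pos j).ne' (add_right_cancel h)
    exact hn (by exact_mod_cast (by linarith : (i.1 : ℝ) = j.1))
  · rw [inner_hermiteMode]
    refine (integral_toLp_mul (memLp_modeTest (memLp_hermiteFun j) j.2) _).trans
      (integral_modeTest_mul_modeTest ?_)
    intro h
    exact hk (Subtype.ext (by omega))

theorem hermiteMode_ne_zero (i : Idx) : hermiteMode i ≠ 0 := by
  intro h
  have h1 : (memLp_modeTest (memLp_hermiteFun i) i.2).toLp _ = (0 : L2) := congrArg Subtype.val h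
  have h2 := (Lp.eq_zero_iff_ae_eq_zero.mp h1)
  have h3 : modeTest (hermiteFun i) i.2 =ᵐ[volume] 0 :=
    (MemLp.coeFn_toLp (memLp_modeTest (memLp_hermiteFun i) i.2)).symm.trans h2
  have hc : Continuous (modeTest (hermiteFun i) i.2) :=
    (Complex.continuous_ofReal.comp ((contDiff_hermiteFun i).continuous.comp continuous_fst)).mul
      ((fourier _).continuous.comp continuous_snd)
  have h4 := (hc.ae_eq_iff_eq volume continuous_zero).mp h3
  refine hermitePoly_ne_zero (abs_frequency_pos i).ne' i.1 (Polynomial.funext fun x => ?_)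
  have h5 := norm_modeTest (hermiteFun i) i.2 (x, 0)
  rw [h4, Pi.zero_apply, norm_zero, eq_comm, abs_eq_zero, hermiteFun, gaussPoly] at h5
  simpa using (mul_eq_zero.mp h5).resolve_right (Real.exp_pos _).ne'

theorem linearIndependent_hermiteMode : LinearIndependent ℂ hermiteMode :=
  linearIndependent_of_ne_zero_of_inner_eq_zero hermiteMode_ne_zero
    fun _ _ => inner_hermiteMode_hermiteMode

/-! ### Completeness of the eigenfunctions -/

theorem eq_zero_of_modes_ae_zero (u : L2)
    (h : ∀ k : ℤ, ∀ᵐ x : ℝ, ∫ y, u (x, y) * fourier k y = 0) : u = 0 := by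
  have h2 : ∀ᵐ x : ℝ, ∀ᵐ y : AddCircle (2 * Real.pi), u (x, y) = 0 := by
    filter_upwards [ae_all_iff.mpr h, slice_memLp u] with x hx hm
    exact circle_ae_zero hm hx
  rw [Lp.eq_zero_iff_ae_eq_zero]
  have hm : MeasurableSet {p : Cyl | u p = 0} :=
    (Lp.stronglyMeasurable u).measurable (measurableSet_singleton 0)
  exact (Measure.ae_prod_iff_ae_ae hm).mpr h2

theorem integral_mul_modeTest_eq_integral_mode (u : L2) {h : ℝ → ℝ} (hh : MemLp h 2) (k : ℤ) :
    Integrable (fun x => (h x : ℂ) * ∫ y, u (x, y) * fourier k y) ∧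
    ∫ p, u p * modeTest h k p = ∫ x, (h x : ℂ) * ∫ y, u (x, y) * fourier k y := by
  have hi : Integrable (fun p : ℝ × AddCircle (2 * Real.pi) => u p * modeTest h k p)
      ((volume : Measure ℝ).prod volume) := integrable_mul_modeTest u hh k
  have e : ∀ x, ∫ y, u (x, y) * modeTest h k (x, y)
      = (h x : ℂ) * ∫ y, u (x, y) * fourier k y := by
    intro x
    rw [← integral_const_mul]
    congr 1
    funext y
    simp only [modeTest]
    ring
  refine ⟨hi.integral_prod_left.congr (Eventually.of_forall e), ?_⟩
  refine (integral_prod _ hi).trans (integral_congr_ae (Eventually.of_forall e))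

/-- Pairing `u` with a polynomial times the Gaussian is linear in the polynomial, so vanishing on
the Hermite polynomials gives vanishing on all powers of `x`. The Gaussian times the `k`-th mode of
`u` thus has zero moments, and it has the decay that `ae_eq_zero_of_moments` requires. -/
theorem mode_ae_zero_of_integral_gaussPoly (u : L2) (k : ℤ) {w : ℝ} (hw : 0 < w)
    (h : ∀ n : ℕ, ∫ p, u p * modeTest (gaussPoly w (hermitePoly w n)) k p = 0) :
    ∀ᵐ x : ℝ, ∫ y, u (x, y) * fourier k y = 0 := by
  let L : Polynomial ℝ →ₗ[ℝ] ℂ :=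
    { toFun := fun p => ∫ q, u q * modeTest (gaussPoly w p) k q
      map_add' := fun p q => by
        rw [← integral_add (integrable_mul_modeTest u (memLp_gaussPoly hw p) k)
          (integrable_mul_modeTest u (memLp_gaussPoly hw q) k)]
        congr 1
        funext z
        simp only [modeTest, gaussPoly, Polynomial.eval_add]
        push_cast
        ring
      map_smul' := fun c p => by
        rw [RingHom.id_apply, Complex.real_smul, ← integral_const_mul]
        congr 1
        funext z
        simp only [modeTest, gaussPoly, Polynomial.eval_smul, smul_eq_mul]
        push_cast
        ring }
  have hker : Submodule.span ℝ (Set.range (hermitePoly w)) ≤ LinearMap.ker L :=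
    Submodule.span_le.mpr (by rintro _ ⟨n, rfl⟩; exact h n)
  have hX : ∀ n : ℕ, ∫ p, u p * modeTest (gaussPoly w (Polynomial.X ^ n)) k p = 0 :=
    fun n => hker (X_pow_mem_span_hermitePoly hw.ne' n)
  have hv : AEStronglyMeasurable
      fun x => (gaussPoly w 1 x : ℂ) * ∫ y, u (x, y) * fourier k y :=
    (integral_mul_modeTest_eq_integral_mode u (memLp_gaussPoly hw 1) k).1.1
  have hz := ae_eq_zero_of_moments (fun a => ?_) hv fun n => ?_
  · filter_upwards [hz] with x hx
    refine (mul_eq_zero.mp hx).resolve_left ?_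
    simp [gaussPoly]
  · refine (integral_mul_modeTest_eq_integral_mode u
      (memLp_gaussPoly_mul_exp hw 1 a) k).1.norm.congr (Eventually.of_forall fun x => ?_)
    simp only [norm_mul, Complex.ofReal_mul, Complex.norm_real, Real.norm_eq_abs, Real.abs_exp]
    ring
  · rw [← hX n, (integral_mul_modeTest_eq_integral_mode u (memLp_gaussPoly hw _) k).2]
    congr 1
    funext x
    simp only [gaussPoly, Polynomial.eval_pow, Polynomial.eval_X, Polynomial.eval_one]
    push_cast
    ring

theorem eq_zero_of_inner_hermiteMode {u : L20} (h : ∀ i, inner ℂ (hermiteMode i) u = 0) :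
    u = 0 := by
  refine Subtype.ext (eq_zero_of_modes_ae_zero _ fun k => ?_)
  by_cases hk : k = 0
  · subst hk
    refine mode_ae_zero _ 0 fun ψ hψ hc => ?_
    simpa [modeTest] using integral_mode_zero u.2 hψ.continuous hc
  -- By conjugation, the inner product with a mode of frequency `-k` integrates `u` against
  -- `e^{iky}`.
  · have hpos : 0 < |((-k : ℤ) : ℝ)| := abs_frequency_pos (0, ⟨-k, neg_ne_zero.mpr hk⟩)
    refine mode_ae_zero_of_integral_gaussPoly _ k hpos fun n => ?_
    have := h (n, ⟨-k, neg_ne_zero.mpr hk⟩)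
    rw [inner_hermiteMode] at this
    simpa only [neg_neg, hermiteFun] using this

/-! ### The spectral subspaces -/

/-- The index `(n, ± (m + 1))`. -/
def signedIdx (t : (Σ _ : ℕ, ℕ) × Bool) : Idx :=
  (t.1.2, ⟨if t.2 then (t.1.1 : ℤ) + 1 else -((t.1.1 : ℤ) + 1), by split_ifs <;> omega⟩)

theorem signedIdx_injective : Function.Injective signedIdx := by
  rintro ⟨⟨m, n⟩, b⟩ ⟨⟨m', n'⟩, b'⟩ h
  simp only [signedIdx, Prod.mk.injEq, Subtype.mk.injEq] at h
  obtain ⟨rfl, h⟩ := h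
  cases b <;> cases b' <;> simp at h ⊢ <;> omega

theorem level_signedIdx (s : ℝ) (t : (Σ _ : ℕ, ℕ) × Bool) :
    level s (signedIdx t)
      = (2 * t.1.2 + 1) * ((t.1.1 + 1 : ℕ) : ℝ) + ((t.1.1 + 1 : ℕ) : ℝ) ^ 2 * s ^ 2 := by
  obtain ⟨⟨m, n⟩, b⟩ := t
  have h : |(m : ℝ) + 1| = m + 1 := abs_of_nonneg (by positivity)
  cases b
  · simp only [level, signedIdx, Bool.false_eq_true, if_false]
    push_cast
    rw [abs_neg, h]
    ring
  · simp [level, signedIdx, h]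

/-- The indices of the eigenvalues that are at most `E`. -/
def lowIdx (s E : ℝ) : Finset ((Σ _ : ℕ, ℕ) × Bool) :=
  ((Finset.range ⌊E⌋₊).sigma fun m => Finset.range (levelCount s E (m + 1))) ×ˢ Finset.univ

theorem image_lowIdx (s E : ℝ) :
    signedIdx '' (lowIdx s E : Set ((Σ _ : ℕ, ℕ) × Bool)) = {i | level s i ≤ E} := by
  have key : ∀ t, t ∈ lowIdx s E ↔ level s (signedIdx t) ≤ E := by
    intro t
    have h1 := lt_levelCount_iff (s := s) (E := E) (k := t.1.1 + 1) (by omega) t.1.2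
    simp only [lowIdx, Finset.mem_product, Finset.mem_sigma, Finset.mem_range, Finset.mem_univ,
      and_true]
    rw [h1, ← level_signedIdx, and_iff_right_iff_imp]
    intro h
    -- Every level of frequency `± (m+1)` is at least `m + 1`, so the restriction `m < ⌊E⌋₊` loses
    -- nothing.
    rw [← Nat.add_one_le_iff]
    refine Nat.le_floor (le_trans ?_ h)
    rw [level_signedIdx]
    have h2 : (0 : ℝ) ≤ ((t.1.1 + 1 : ℕ) : ℝ) := Nat.cast_nonneg _
    have h3 : (0 : ℝ) ≤ (t.1.2 : ℝ) * ((t.1.1 + 1 : ℕ) : ℝ) := by positivity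
    have h4 : 0 ≤ ((t.1.1 + 1 : ℕ) : ℝ) ^ 2 * s ^ 2 := by positivity
    linarith
  ext i
  constructor
  · rintro ⟨t, ht, rfl⟩
    exact (key t).mp ht
  · intro hi
    obtain ⟨n, k, hk⟩ := i
    have : ∃ t, signedIdx t = (n, ⟨k, hk⟩) := by
      refine ⟨(⟨k.natAbs - 1, n⟩, decide (0 < k)), ?_⟩
      simp only [signedIdx, Prod.mk.injEq, Subtype.mk.injEq, true_and, decide_eq_true_eq]
      split_ifs <;> omega
    obtain ⟨t, ht⟩ := this
    exact ⟨t, (key t).mpr (ht ▸ hi), ht⟩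

/-- The span `W` is finite-dimensional, so an eigenvector splits as `w + z` with `w ∈ W` and `z ⊥
W`. Modes of level above `μ` are orthogonal to the eigenvector and to `w`, hence to `z`;
completeness then forces `z = 0`. -/
theorem eigenspace_le_span (s μ : ℝ) :
    eigenspace (P s) (μ : ℂ) ≤ Submodule.span ℂ (hermiteMode '' {i | level s i ≤ μ}) := by
  intro u hu
  set W := Submodule.span ℂ (hermiteMode '' {i | level s i ≤ μ}) with hW
  have hfin : (hermiteMode '' {i | level s i ≤ μ}).Finite := by
    rw [← image_lowIdx]
    exact ((lowIdx s μ).finite_toSet.image _).image _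
  have : FiniteDimensional ℂ W := FiniteDimensional.span_of_finite ℂ hfin
  obtain ⟨w, hw, z, hz, rfl⟩ := W.exists_add_mem_mem_orthogonal u
  have hz0 : z = 0 := by
    refine eq_zero_of_inner_hermiteMode fun i => ?_
    by_cases hi : level s i ≤ μ
    · exact (Submodule.mem_orthogonal _ _).mp hz _ (Submodule.subset_span ⟨i, hi, rfl⟩)
    · have h1 := inner_hermiteMode_eq_zero_of_mem_eigenspace hu (i := i) (fun h => hi h.le)
      have h2 : W ≤ (Submodule.span ℂ {hermiteMode i})ᗮ := by
        refine Submodule.span_le.mpr ?_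
        rintro _ ⟨j, hj, rfl⟩
        refine Submodule.mem_orthogonal_singleton_iff_inner_right.mpr
          (inner_hermiteMode_hermiteMode ?_)
        rintro rfl
        exact hi hj
      rwa [inner_add_right, Submodule.mem_orthogonal_singleton_iff_inner_right.mp (h2 hw),
        zero_add] at h1
  rw [hz0, add_zero]
  exact hw

theorem spectralSubspace_P (s E : ℝ) :
    spectralSubspace (P s) E = Submodule.span ℂ (hermiteMode '' {i | level s i ≤ E}) := by
  refine le_antisymm (iSup₂_le fun μ hμ => (eigenspace_le_span s μ).trans
    (Submodule.span_mono (Set.image_mono fun i hi => le_trans hi hμ))) (Submodule.span_le.mpr ?_)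
  rintro _ ⟨i, hi, rfl⟩
  exact Submodule.mem_iSup_of_mem (level s i)
    (Submodule.mem_iSup_of_mem hi (hermiteMode_mem_eigenspace s i))

theorem finiteDimensional_spectralSubspace_P (s E : ℝ) :
    FiniteDimensional ℂ (spectralSubspace (P s) E) := by
  rw [spectralSubspace_P, ← image_lowIdx]
  exact FiniteDimensional.span_of_finite ℂ (((lowIdx s E).finite_toSet.image _).image _)

theorem counting_P (s E : ℝ) :
    (counting (P s) E : ℝ) = 2 * ∑ k ∈ Finset.Icc 1 ⌊E⌋₊, (levelCount s E k : ℝ) := by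
  have h1 : counting (P s) E = (lowIdx s E).card := by
    have hli : LinearIndependent ℂ fun t : lowIdx s E => hermiteMode (signedIdx t) :=
      linearIndependent_hermiteMode.comp _ (signedIdx_injective.comp Subtype.val_injective)
    have h := finrank_span_eq_card hli
    rw [Fintype.card_coe] at h
    rw [counting, spectralSubspace_P, ← image_lowIdx, ← h]
    rw [Set.image_image, Set.image_eq_range]
    rfl
  rw [h1, lowIdx, Finset.card_product, Finset.card_sigma]
  simp only [Finset.card_range, Finset.card_univ, Fintype.card_bool]
  push_cast
  -- The factor `2` counts the two signs of the frequency; the shift turns `m` into `k = m + 1`.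
  rw [mul_comm, Finset.range_eq_Ico, Finset.sum_Ico_add' (fun k => (levelCount s E k : ℝ)) 0 _ 1]
  rfl

end Grushin

end

theorem mainTheorem6 :
    (∀ (s E : ℝ), FiniteDimensional ℂ (Grushin.spectralSubspace (Grushin.P s) E)) ∧
    (fun E : ℝ => (Grushin.counting (Grushin.P 0) E : ℝ) - E * Real.log E)
      =O[atTop] (fun E : ℝ => E) ∧
    ∀ s : ℝ, s ≠ 0 →
      (fun E : ℝ => (Grushin.counting (Grushin.P s) E : ℝ) - E * Real.log (Real.sqrt E))
        =O[atTop] (fun E : ℝ => E) := by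
  refine ⟨Grushin.finiteDimensional_spectralSubspace_P, ?_, fun s hs => ?_⟩
  · simpa only [Grushin.counting_P] using Grushin.sum_levelCount_zero_isBigO
  · simpa only [Grushin.counting_P] using Grushin.sum_levelCount_isBigO hs
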